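/- Let $d\in\{2,3\}$, let $\Omega\subset\mathbb{R}^d$ be a convex polygonal ($d=2$) or polyhedral ($d=3$) domain, and let $c^2>0$, $b>0$, $\alpha_0>0$. Write $(\cdot,\cdot)$ for the $L^2(\Omega)$ inner product, $|\cdot|_{L^p}$ for the norm of $L^p(\Omega)$ and $\|\cdot\|_{L^qL^p}$ for the norm of $L^q(0,T;L^p(\Omega))$. For a (conforming) triangulation $\mathcal{T}_h$ of $\Omega$ into triangles (tetrahedra), let $$S_h=\{v\in H_0^1(\Omega):\ v|_K \text{ is a polynomial of degree at most } 1 \text{ for every } K\in\mathcal{T}_h\}.$$ There are constants $0<C_1,C_2<\infty$, depending only on $\Omega$, $c$, $b$ and $\alpha_0$ (in particular not on the mesh), such that the following holds for every $T>0$, every triangulation $\mathcal{T}_h$ of $\Omega$, all $u_{h,0},u_{h,1}\in S_h$ and all measurable functions $\alpha_h,\beta_h,f_h$ on $(0,T)\times\Omega$ with $$\alpha_h\in L^\infty(0,T;L^\infty(\Omega)),\quad \alpha_h\ge\alpha_0 \text{ a.e. in } \Omega\times(0,T),\quad \beta_h\in L^\infty(0,T;L^3(\Omega)),\quad f_h\in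 L^2(0,T;L^2(\Omega)).$$ There exists a unique $u_h\in H^2(0,T;S_h)$ such that $$(\alpha_h u_{h,tt},\phi)+c^2(\nabla u_h,\nabla\phi)+b(\nabla u_{h,t},\nabla\phi)+(\beta_h u_{h,t},\phi)=(f_h,\phi)\qquad\text{for all }\phi\in S_h,\ \text{a.e. in } (0,T),$$ and $(u_h(0),u_{h,t}(0))=(u_{h,0},u_{h,1})$. Moreover, $$\|u_{h,tt}\|^2_{L^2L^2}+\|\nabla u_h\|^2_{L^\infty L^2}+\|\nabla u_{h,t}\|^2_{L^\infty L^2}+\|\nabla u_{h,t}\|^2_{L^2L^2}\le C_1\exp\!\big(C_2(\|\alpha_h\|^2_{L^\infty L^3}+\|\beta_h\|^2_{L^\infty L^3}+1)\,T\big)\,\big(|\nabla u_{h,0}|^2_{L^2}+|\nabla u_{h,1}|^2_{L^2}+\|f_h\|^2_{L^2L^2}\big).$$ -/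

import Mathlib

open MeasureTheory Set TopologicalSpace
open scoped ENNReal Gradient Distributions ContDiff

namespace StrongDamping

noncomputable section

/-! ### Domain and triangulation -/

/-- The Euclidean space `ℝᵈ`. -/
abbrev Space (d : ℕ) : Type := EuclideanSpace ℝ (Fin d)

/-- `Ω` is a convex polygonal (`d = 2`) or polyhedral (`d = 3`) domain: the nonempty interior of the
convex hull of finitely many points. -/
def IsConvexPolytope {d : ℕ} (Ω : Opens (Space d)) : Prop :=
  (Ω : Set (Space d)).Nonempty ∧
    ∃ s : Finset (Space d), (Ω : Set (Space d)) = interior (convexHull ℝ (s : Set (Space d)))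

/-- A (conforming) triangulation of `Ω` into triangles (`d = 2`) or tetrahedra (`d = 3`): a finite
simplicial complex whose `d`-dimensional simplices cover `closure Ω` exactly. -/
structure Triangulation {d : ℕ} (Ω : Opens (Space d)) where
  complex : Geometry.SimplicialComplex ℝ (Space d)
  finite_faces : complex.faces.Finite
  cover : closure (Ω : Set (Space d)) =
    ⋃ s ∈ {s ∈ complex.faces | s.card = d + 1}, convexHull ℝ (s : Set (Space d))

/-- The vertex sets of the elements `K` (triangles or tetrahedra) of a triangulation. -/
def Triangulation.elements {d : ℕ} {Ω : Opens (Space d)} (𝒯 : Triangulation Ω) :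
    Set (Finset (Space d)) :=
  {s ∈ 𝒯.complex.faces | s.card = d + 1}

/-! ### The space `H₀¹(Ω)` and the finite element space -/

/-- Lebesgue measure on `Ω`. -/
abbrev vol {d : ℕ} (Ω : Opens (Space d)) : Measure (Space d) :=
  volume.restrict (Ω : Set (Space d))

/-- The Hilbert space `L²(Ω) × L²(Ω)ᵈ`, in which `H¹(Ω)` sits isometrically as the set of pairs
`(u, ∇u)`. -/
abbrev L2Pair {d : ℕ} (Ω : Opens (Space d)) : Type :=
  WithLp 2 (Lp ℝ 2 (vol Ω) × Lp (Space d) 2 (vol Ω))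

/-- The pairs `(φ, ∇φ)` with `φ ∈ C_c^∞(Ω)`. -/
def testPairs {d : ℕ} (Ω : Opens (Space d)) : Submodule ℝ (L2Pair Ω) where
  carrier := {p | ∃ φ : 𝓓(Ω, ℝ), p.fst =ᵐ[vol Ω] φ ∧ p.snd =ᵐ[vol Ω] ∇ (φ : Space d → ℝ)}
  zero_mem' := by
    refine ⟨0, ?_, ?_⟩
    · exact Lp.coeFn_zero ..
    · refine (Lp.coeFn_zero ..).trans (.of_forall fun x => ?_)
      simp [gradient]
  add_mem' := by
    rintro p q ⟨φ, h1, h2⟩ ⟨ψ, h3, h4⟩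
    refine ⟨φ + ψ, ?_, ?_⟩
    · exact (Lp.coeFn_add ..).trans (h1.add h3)
    · refine (Lp.coeFn_add ..).trans ((h2.add h4).trans (.of_forall fun x => ?_))
      have hφ := φ.contDiff.differentiable (by simp) x
      have hψ := ψ.contDiff.differentiable (by simp) x
      simp [gradient, fderiv_add hφ hψ]
  smul_mem' := by
    rintro c p ⟨φ, h1, h2⟩
    refine ⟨c • φ, ?_, ?_⟩
    · exact (Lp.coeFn_smul ..).trans (h1.const_smul c)
    · refine (Lp.coeFn_smul ..).trans ((h2.const_smul c).trans (.of_forall fun x => ?_))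
      have hφ := φ.contDiff.differentiable (by simp) x
      simp [gradient, fderiv_const_smul hφ]

/-- `H₀¹(Ω)`, the closure of `C_c^∞(Ω)` in the `H¹` norm. Its elements are the pairs `(u, ∇u)`;
the weak gradient is determined by the function, see `snd_eq_zero`. -/
def H01 {d : ℕ} (Ω : Opens (Space d)) : Submodule ℝ (L2Pair Ω) :=
  (testPairs Ω).topologicalClosure

/-- The second component of an element of `H₀¹(Ω)` is the weak gradient of the first one. -/
theorem weak_gradient {d : ℕ} {Ω : Opens (Space d)} {p : L2Pair Ω} (hp : p ∈ H01 Ω)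
    (ψ : 𝓓(Ω, ℝ)) (v : Space d) :
    ∫ x, p.fst x * fderiv ℝ ψ x v ∂(vol Ω) = - ∫ x, inner ℝ (p.snd x) v * ψ x ∂(vol Ω) := by
  have hψs : ContDiff ℝ ∞ ψ := ψ.contDiff
  have hcF : ∀ η : 𝓓(Ω, ℝ), Continuous fun x => fderiv ℝ η x v := fun η =>
    ((show ContDiff ℝ ∞ η from η.contDiff).continuous_fderiv (by simp)).clm_apply
      continuous_const
  have hsF : ∀ η : 𝓓(Ω, ℝ), HasCompactSupport fun x => fderiv ℝ η x v := fun η =>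
    η.hasCompactSupport.fderiv_apply (𝕜 := ℝ) v
  have mF : MemLp (fun x => fderiv ℝ ψ x v) 2 (vol Ω) :=
    (hcF ψ).memLp_of_hasCompactSupport (hsF ψ)
  have mG : MemLp (fun x => ψ x • v) 2 (vol Ω) :=
    (ψ.continuous.smul continuous_const).memLp_of_hasCompactSupport
      ψ.hasCompactSupport.smul_right
  have key : ∀ q : L2Pair Ω, inner ℝ mF.toLp q.fst + inner ℝ mG.toLp q.snd
      = (∫ x, q.fst x * fderiv ℝ ψ x v ∂(vol Ω)) + ∫ x, inner ℝ (q.snd x) v * ψ x ∂(vol Ω) := by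
    intro q
    rw [L2.inner_def, L2.inner_def]
    congr 1
    · refine integral_congr_ae ?_
      filter_upwards [mF.coeFn_toLp] with x hx
      rw [hx]; simp
    · refine integral_congr_ae ?_
      filter_upwards [mG.coeFn_toLp] with x hx
      rw [hx, inner_smul_left, real_inner_comm, mul_comm]; simp
  suffices h : inner ℝ mF.toLp p.fst + inner ℝ mG.toLp p.snd = 0 by
    rw [key] at h; linarith
  have hcl : IsClosed {q : L2Pair Ω | inner ℝ mF.toLp q.fst + inner ℝ mG.toLp q.snd = 0} :=
    isClosed_eq ((continuous_const.inner (WithLp.continuous_fst ..)).add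
      (continuous_const.inner (WithLp.continuous_snd ..))) continuous_const
  refine closure_minimal ?_ hcl hp
  rintro q ⟨φ, h1, h2⟩
  rw [mem_ofPred_eq, key]
  have hφd : Differentiable ℝ φ := φ.contDiff.differentiable (by simp)
  have hψd : Differentiable ℝ ψ := ψ.contDiff.differentiable (by simp)
  have e1 : ∫ x, q.fst x * fderiv ℝ ψ x v ∂(vol Ω) = ∫ x, φ x * fderiv ℝ ψ x v := by
    rw [integral_congr_ae (g := fun x => φ x * fderiv ℝ ψ x v)
      (by filter_upwards [h1] with x hx; rw [hx])]
    refine setIntegral_eq_integral_of_forall_compl_eq_zero fun x hx => ?_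
    rw [image_eq_zero_of_notMem_tsupport fun h => hx (φ.tsupport_subset h), zero_mul]
  have e2 : ∫ x, inner ℝ (q.snd x) v * ψ x ∂(vol Ω) = ∫ x, fderiv ℝ φ x v * ψ x := by
    rw [integral_congr_ae (g := fun x => fderiv ℝ φ x v * ψ x)
      (by filter_upwards [h2] with x hx; rw [hx]; simp [gradient])]
    refine setIntegral_eq_integral_of_forall_compl_eq_zero fun x hx => ?_
    rw [image_eq_zero_of_notMem_tsupport fun h => hx (ψ.tsupport_subset h), mul_zero]
  rw [e1, e2, integral_mul_fderiv_eq_neg_fderiv_mul_of_integrable, neg_add_cancel]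
  · exact ((hcF φ).mul ψ.continuous).integrable_of_hasCompactSupport
      ψ.hasCompactSupport.mul_left
  · exact (φ.continuous.mul (hcF ψ)).integrable_of_hasCompactSupport
      φ.hasCompactSupport.mul_right
  · exact (φ.continuous.mul ψ.continuous).integrable_of_hasCompactSupport
      φ.hasCompactSupport.mul_right
  · exact fun x _ => hφd x
  · exact fun x _ => hψd x

/-- An element of `H₀¹(Ω)` whose function component vanishes is zero: the function determines its
weak gradient. -/
theorem snd_eq_zero {d : ℕ} {Ω : Opens (Space d)} {p : L2Pair Ω} (hp : p ∈ H01 Ω)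
    (h0 : p.fst = 0) : p.snd = 0 := by
  have hv : ∀ v : Space d, ∀ᵐ x ∂(vol Ω), inner ℝ (p.snd x) v = 0 := by
    intro v
    have hm : MemLp (fun x => inner ℝ (p.snd x) v) 2 (vol Ω) := (Lp.memLp p.snd).inner_const v
    rw [ae_restrict_iff' Ω.isOpen.measurableSet]
    refine Ω.isOpen.ae_eq_zero_of_integral_contDiff_smul_eq_zero ?_ ?_
    · exact (locallyIntegrableOn_of_locallyIntegrable_restrict
        (hm.locallyIntegrable (by norm_num)))
    · intro g hg hgc hgs
      have := weak_gradient hp ⟨g, hg, hgc, hgs⟩ v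
      have hz : ∫ x, p.fst x * fderiv ℝ g x v ∂(vol Ω) = 0 := by
        rw [integral_congr_ae (g := fun _ => (0 : ℝ)), integral_zero]
        rw [h0]
        filter_upwards [Lp.coeFn_zero (E := ℝ) (p := 2) (μ := vol Ω)] with x hx
        rw [hx]; simp
      have hw : ∫ x, inner ℝ (p.snd x) v * g x ∂(vol Ω) = 0 := by
        have h' : ∫ x, p.fst x * fderiv ℝ g x v ∂(vol Ω)
          = - ∫ x, inner ℝ (p.snd x) v * g x ∂(vol Ω) := this
        rw [hz] at h'; linarith
      rw [← setIntegral_eq_integral_of_forall_compl_eq_zero (s := (Ω : Set (Space d)))]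
      · simpa [mul_comm] using hw
      · intro x hx
        rw [image_eq_zero_of_notMem_tsupport fun h => hx (hgs h), zero_smul]
  rw [Lp.eq_zero_iff_ae_eq_zero]
  have hall := ae_all_iff.2 fun i : Fin d => hv (EuclideanSpace.single i 1)
  filter_upwards [hall] with x hx
  ext i
  have hi := hx i
  rw [PiLp.inner_apply, Finset.sum_eq_single i] at hi
  · simpa using hi
  · intro j _ hj
    simp [hj]
  · simp

/-- The finite element space
`S_h = {u ∈ H₀¹(Ω) : u|_K is a polynomial of degree at most one for every element K}`,
with the norm of `H¹(Ω)`. -/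
def femSpace {d : ℕ} {Ω : Opens (Space d)} (𝒯 : Triangulation Ω) : Submodule ℝ (L2Pair Ω) where
  carrier := {p | p ∈ H01 Ω ∧ ∀ K ∈ 𝒯.elements, ∃ (a : Space d) (b : ℝ),
    ∀ᵐ x ∂(vol Ω), x ∈ convexHull ℝ (K : Set (Space d)) → p.fst x = inner ℝ a x + b}
  zero_mem' := by
    refine ⟨zero_mem _, fun K _ => ⟨0, 0, ?_⟩⟩
    filter_upwards [Lp.coeFn_zero (E := ℝ) (p := 2) (μ := vol Ω)] with x hx _
    simpa using hx
  add_mem' := by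
    rintro p q ⟨hp, hp'⟩ ⟨hq, hq'⟩
    refine ⟨add_mem hp hq, fun K hK => ?_⟩
    obtain ⟨a, b, h⟩ := hp' K hK
    obtain ⟨a', b', h'⟩ := hq' K hK
    refine ⟨a + a', b + b', ?_⟩
    filter_upwards [h, h', Lp.coeFn_add p.fst q.fst] with x h1 h2 h3 hx
    rw [WithLp.add_fst, h3, Pi.add_apply, h1 hx, h2 hx, inner_add_left]
    ring
  smul_mem' := by
    rintro c p ⟨hp, hp'⟩
    refine ⟨Submodule.smul_mem _ c hp, fun K hK => ?_⟩
    obtain ⟨a, b, h⟩ := hp' K hK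
    refine ⟨c • a, c * b, ?_⟩
    filter_upwards [h, Lp.coeFn_smul c p.fst] with x h1 h3 hx
    rw [WithLp.smul_fst, h3, Pi.smul_apply, h1 hx, inner_smul_left]
    simp [mul_add]

/-- The function underlying an element of the finite element space. -/
def fn {d : ℕ} {Ω : Opens (Space d)} {𝒯 : Triangulation Ω} (v : femSpace 𝒯) :
    Lp ℝ 2 (vol Ω) := (v : L2Pair Ω).fst

/-- The gradient of an element of the finite element space. -/
def grad {d : ℕ} {Ω : Opens (Space d)} {𝒯 : Triangulation Ω} (v : femSpace 𝒯) :
    Lp (Space d) 2 (vol Ω) := (v : L2Pair Ω).snd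

/-- The finite element space is finite-dimensional. -/
instance {d : ℕ} {Ω : Opens (Space d)} (𝒯 : Triangulation Ω) :
    FiniteDimensional ℝ (femSpace 𝒯) := by
  classical
  have : Finite 𝒯.elements := (𝒯.finite_faces.subset (sep_subset _ _)).to_subtype
  let μK : 𝒯.elements → Measure (Space d) := fun K =>
    (vol Ω).restrict (convexHull ℝ ((K : Finset (Space d)) : Set (Space d)))
  have hle : ∀ K, μK K ≤ vol Ω := fun K => Measure.restrict_le_self
  have hKm : ∀ K : 𝒯.elements,
      MeasurableSet (convexHull ℝ ((K : Finset (Space d)) : Set (Space d))) := fun K =>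
    (K : Finset (Space d)).finite_toSet.isCompact_convexHull (𝕜 := ℝ) |>.isClosed.measurableSet
  let A : ∀ K, (Space d × ℝ) →ₗ[ℝ] (Space d →ₘ[μK K] ℝ) := fun K =>
    { toFun := fun z => AEEqFun.mk (fun x => inner ℝ z.1 x + z.2)
        (by fun_prop : Continuous fun x : Space d => inner ℝ z.1 x + z.2).aestronglyMeasurable
      map_add' := fun y z => by
        rw [AEEqFun.mk_add_mk, AEEqFun.mk_eq_mk]
        refine .of_forall fun x => ?_
        simp [inner_add_left]; ring
      map_smul' := fun c z => by
        rw [RingHom.id_apply, AEEqFun.smul_mk, AEEqFun.mk_eq_mk]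
        refine .of_forall fun x => ?_
        simp [inner_smul_left]; ring }
  let R : femSpace 𝒯 →ₗ[ℝ] (∀ K, Space d →ₘ[μK K] ℝ) :=
    { toFun := fun p K => AEEqFun.mk ((p : L2Pair Ω).fst)
        ((Lp.aestronglyMeasurable _).mono_measure (hle K))
      map_add' := fun p q => by
        funext K
        rw [Pi.add_apply, AEEqFun.mk_add_mk, AEEqFun.mk_eq_mk]
        exact ae_mono (hle K) (Lp.coeFn_add ..)
      map_smul' := fun c p => by
        funext K
        rw [RingHom.id_apply, Pi.smul_apply, AEEqFun.smul_mk, AEEqFun.mk_eq_mk]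
        exact ae_mono (hle K) (Lp.coeFn_smul ..) }
  let B : (𝒯.elements → Space d × ℝ) →ₗ[ℝ] (∀ K, Space d →ₘ[μK K] ℝ) :=
    LinearMap.pi fun K => (A K).comp (LinearMap.proj K)
  have hrange : LinearMap.range R ≤ LinearMap.range B := by
    rintro _ ⟨p, rfl⟩
    have hp := p.2.2
    choose a b hab using hp
    refine ⟨fun K => (a K K.2, b K K.2), ?_⟩
    funext K
    change AEEqFun.mk _ _ = AEEqFun.mk _ _
    rw [AEEqFun.mk_eq_mk]
    have := (ae_restrict_iff' (hKm K)).2 (hab K K.2)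
    filter_upwards [this] with x hx
    exact hx.symm
  have hinj : Function.Injective R := by
    rw [← LinearMap.ker_eq_bot, LinearMap.ker_eq_bot']
    intro p hp
    have h0 : (p : L2Pair Ω).fst = 0 := by
      rw [Lp.eq_zero_iff_ae_eq_zero]
      have hK : ∀ K : 𝒯.elements, ∀ᵐ x ∂(vol Ω),
          x ∈ convexHull ℝ ((K : Finset (Space d)) : Set (Space d)) →
            (p : L2Pair Ω).fst x = 0 := by
        intro K
        rw [← ae_restrict_iff' (hKm K)]
        have h1 : AEEqFun.mk ((p : L2Pair Ω).fst)
          ((Lp.aestronglyMeasurable _).mono_measure (hle K)) = (0 : Space d →ₘ[μK K] ℝ) :=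
          congrFun hp K
        rw [AEEqFun.zero_def, AEEqFun.mk_eq_mk] at h1
        exact h1
      filter_upwards [ae_all_iff.2 hK, ae_restrict_mem Ω.isOpen.measurableSet] with x hx hxΩ
      have : x ∈ closure (Ω : Set (Space d)) := subset_closure hxΩ
      rw [𝒯.cover] at this
      simp only [mem_iUnion] at this
      obtain ⟨s, hs, hxs⟩ := this
      exact hx ⟨s, hs⟩ hxs
    have h1 : (p : L2Pair Ω).snd = 0 := snd_eq_zero p.2.1 h0
    exact Subtype.ext ((WithLp.ofLp_injective 2) (Prod.ext h0 h1))
  have : FiniteDimensional ℝ (LinearMap.range R) :=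
    Submodule.finiteDimensional_of_le hrange
  exact Module.Finite.equiv (LinearEquiv.ofInjective R hinj).symm

instance {d : ℕ} {Ω : Opens (Space d)} (𝒯 : Triangulation Ω) : CompleteSpace (femSpace 𝒯) :=
  FiniteDimensional.complete ℝ _

/-! ### Functions of time -/

/-- The time interval `(0, T)`. -/
def timeInterval (T : ℝ) : Opens ℝ := ⟨Ioo 0 T, isOpen_Ioo⟩

/-- Lebesgue measure on `(0, T)`. -/
abbrev timeVol (T : ℝ) : Measure ℝ := volume.restrict (Ioo 0 T)

/-- `v` is the weak derivative on `(0, T)` of the `X`-valued function `u`. -/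
def HasWeakTimeDeriv {X : Type*} [NormedAddCommGroup X] [NormedSpace ℝ X] [CompleteSpace X]
    (T : ℝ) (u v : ℝ → X) : Prop :=
  ∀ φ : 𝓓(timeInterval T, ℝ),
    ∫ t, deriv φ t • u t ∂(timeVol T) = - ∫ t, φ t • v t ∂(timeVol T)

/-- The Bochner-Sobolev space `H²(0, T; X)`: a class `u ∈ L²(0, T; X)` together with its first and
second weak derivatives (determined by `u`), which lie in `L²(0, T; X)`. -/
structure BochnerH2 (T : ℝ) (X : Type*) [NormedAddCommGroup X] [NormedSpace ℝ X]
    [CompleteSpace X] where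
  val : Lp X 2 (timeVol T)
  dt : Lp X 2 (timeVol T)
  dtt : Lp X 2 (timeVol T)
  hasWeakTimeDeriv_val : HasWeakTimeDeriv T val dt
  hasWeakTimeDeriv_dt : HasWeakTimeDeriv T dt dtt

/-- `u(0) = x`, in the sense of the representative of `u` that is continuous on `[0, T]`. -/
def HasInitialValue {X : Type*} [NormedAddCommGroup X] (T : ℝ) (u : ℝ → X) (x : X) : Prop :=
  ∃ w : ℝ → X, ContinuousOn w (Icc 0 T) ∧ u =ᵐ[timeVol T] w ∧ w 0 = x

/-- The norm of `g` in `L^q(0, T; L^p(Ω))`, where `g t x` is the value at time `t` and point `x`. -/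
def mixedNorm {d : ℕ} (T : ℝ) (Ω : Opens (Space d)) (q p : ℝ≥0∞) (g : ℝ → Space d → ℝ) : ℝ≥0∞ :=
  eLpNorm (fun t => eLpNorm (g t) p (vol Ω)) q (timeVol T)

/-- `g ∈ L^q(0, T; L^p(Ω))`, for a measurable function `g` on `(0, T) × Ω`. -/
def MemMixed {d : ℕ} (T : ℝ) (Ω : Opens (Space d)) (q p : ℝ≥0∞) (g : ℝ → Space d → ℝ) : Prop :=
  AEStronglyMeasurable (Function.uncurry g) ((timeVol T).prod (vol Ω)) ∧
    mixedNorm T Ω q p g < ⊤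

/-! ### The semi-discrete problem -/

/-- `u ∈ H²(0, T; S_h)` satisfies, for almost every `t ∈ (0, T)` and for all `φ ∈ S_h`,
`(α u_tt, φ) + c² (∇u, ∇φ) + b (∇u_t, ∇φ) + (β u_t, φ) = (f, φ)`,
and `(u(0), u_t(0)) = (u₀, u₁)`. -/
structure IsSolution {d : ℕ} {Ω : Opens (Space d)} {𝒯 : Triangulation Ω} (c b T : ℝ)
    (α β f : ℝ → Space d → ℝ) (u₀ u₁ : femSpace 𝒯) (u : BochnerH2 T (femSpace 𝒯)) : Prop where
  equation : ∀ᵐ t ∂(timeVol T), ∀ φ : femSpace 𝒯,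
    (∫ x, α t x * fn (u.dtt t) x * fn φ x ∂(vol Ω))
      + c ^ 2 * inner ℝ (grad (u.val t)) (grad φ)
      + b * inner ℝ (grad (u.dt t)) (grad φ)
      + (∫ x, β t x * fn (u.dt t) x * fn φ x ∂(vol Ω))
      = ∫ x, f t x * fn φ x ∂(vol Ω)
  initial_val : HasInitialValue T u.val u₀
  initial_dt : HasInitialValue T u.dt u₁

end

end StrongDamping

open StrongDamping

/-! The estimate comes from testing the equation with `u_tt` itself. The damping term becomes (b/2)
d/dt |∇u_t|², and the lower bound on α gives α₀|u_tt|². Hölder with 1/3 + 1/6 = 1/2 and the Sobolev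
inequality |v|_{L⁶} ≤ S|∇v|_{L²} (`exists_sobolev`) bound (βu_t, u_tt) by S|β|_{L³}|∇u_t||u_tt|. The
term c²(∇u, ∇u_tt) cannot be absorbed, since |∇u_tt| is not controlled. It is written as d/dt
[c²(∇u, ∇u_t)] − c²|∇u_t|², and the bracket joins the energy Q = (b/2)|∇u_t|² + c²(∇u, ∇u_t) +
A|∇u|², which is coercive for A = c⁴/b + 1. Young's inequality yields Q' + (α₀/2)|u_tt|² ≤ κQ +
|f|²/α₀ (`energy_ineq`), and Gronwall's argument concludes (`energy_estimate`). The rate κ involves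
only |β|², S, b, c and α₀; since S depends on Ω alone, the bound is uniform in the mesh.

For existence, S_h is finite-dimensional and the mass operator weighted by α is coercive, so the
problem is a linear ODE with coefficients measurable in time, solved by a contraction
(`exists_caratheodory`, `exists_secondOrder`). The constants there may depend on the mesh, as they
do not enter the estimate. Uniqueness is the energy estimate for the difference of two solutions.

Elements of H²(0,T;S_h) are identified with iterated primitives of their second derivative
(`BochnerH2.ae_eq_primitive`). These are absolutely continuous, which justifies differentiating the
energy almost everywhere and integrating back. -/

namespace StrongDamping

/-! ### Absolutely continuous functions and weak derivatives in time. -/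

section TimeCalculus

variable {E : Type*} [NormedAddCommGroup E] [NormedSpace ℝ E]

open AbsolutelyContinuousOnInterval Filter in
/-- The primitive of a vector valued integrable function is absolutely continuous. -/
theorem absolutelyContinuousOnInterval_primitive {f : ℝ → E} {a b : ℝ}
    (h : IntervalIntegrable f volume a b) :
    AbsolutelyContinuousOnInterval (fun x ↦ ∫ v in a..x, f v) a b := by
  -- Increments of the primitive of `f` are dominated by those of the primitive of `‖f‖`, a real
  -- function whose absolute continuity is known.
  have h1 := h.norm.absolutelyContinuousOnInterval_intervalIntegral (c := a) (by simp)
  have hmem : ∀ᶠ (I : ℕ × (ℕ → ℝ × ℝ)) in totalLengthFilter ⊓ 𝓟 (disjWithin a b),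
      I ∈ disjWithin a b := eventually_inf_principal.mpr (by simp)
  refine squeeze_zero' ?_ ?_ h1
  · exact .of_forall fun I ↦ Finset.sum_nonneg fun _ _ ↦ dist_nonneg
  · filter_upwards [hmem] with I hI
    refine Finset.sum_le_sum fun i hi ↦ ?_
    have hI1 := hI.1 i hi
    have hx : IntervalIntegrable f volume a (I.2 i).1 :=
      h.mono_set (uIcc_subset_uIcc_left hI1.1)
    have hy : IntervalIntegrable f volume a (I.2 i).2 :=
      h.mono_set (uIcc_subset_uIcc_left hI1.2)
    rw [dist_eq_norm, Real.dist_eq, intervalIntegral.integral_interval_sub_left hx hy,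
      intervalIntegral.integral_interval_sub_left hx.norm hy.norm]
    exact intervalIntegral.norm_integral_le_abs_integral_norm

open AbsolutelyContinuousOnInterval Filter in
/-- Composition of an absolutely continuous function with a Lipschitz one. -/
theorem absolutelyContinuousOnInterval_comp {Y Z : Type*} [PseudoMetricSpace Y]
    [PseudoMetricSpace Z] {f : ℝ → Y} {g : Y → Z} {a b : ℝ} {K : NNReal} {s : Set Y}
    (hf : AbsolutelyContinuousOnInterval f a b) (hs : MapsTo f (uIcc a b) s)
    (hg : LipschitzOnWith K g s) : AbsolutelyContinuousOnInterval (g ∘ f) a b := by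
  have hmem : ∀ᶠ (I : ℕ × (ℕ → ℝ × ℝ)) in totalLengthFilter ⊓ 𝓟 (disjWithin a b),
      I ∈ disjWithin a b := eventually_inf_principal.mpr (by simp)
  have h0 : Tendsto (fun I : ℕ × (ℕ → ℝ × ℝ) ↦
      (K : ℝ) * ∑ i ∈ Finset.range I.1, dist (f (I.2 i).1) (f (I.2 i).2))
      (totalLengthFilter ⊓ 𝓟 (disjWithin a b)) (nhds 0) := by
    simpa using Tendsto.const_mul (K : ℝ) hf
  refine squeeze_zero' ?_ ?_ h0
  · exact .of_forall fun I ↦ Finset.sum_nonneg fun _ _ ↦ dist_nonneg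
  · filter_upwards [hmem] with I hI
    rw [Finset.mul_sum]
    refine Finset.sum_le_sum fun i hi ↦ ?_
    have hI1 := hI.1 i hi
    exact hg.dist_le_mul _ (hs hI1.1) _ (hs hI1.2)

/-- Composition of an absolutely continuous function with a `C¹` one. -/
theorem absolutelyContinuousOnInterval_contDiff_comp {F : Type*} [NormedAddCommGroup F]
    [NormedSpace ℝ F] {f : ℝ → E} {g : E → F} {a b : ℝ}
    (hf : AbsolutelyContinuousOnInterval f a b) (hg : ContDiff ℝ 1 g) :
    AbsolutelyContinuousOnInterval (g ∘ f) a b := by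
  have hK : IsCompact (f '' uIcc a b) := isCompact_uIcc.image_of_continuousOn hf.continuousOn
  obtain ⟨K, hK⟩ := (hg.locallyLipschitz.locallyLipschitzOn (s := f '' uIcc a b)
    ).exists_lipschitzOnWith_of_compact hK
  exact absolutelyContinuousOnInterval_comp hf (mapsTo_image _ _) hK

theorem restrict_Ioo_eq_Ioc (a b : ℝ) :
    (volume : Measure ℝ).restrict (Ioo a b) = volume.restrict (Ioc a b) :=
  Measure.restrict_congr_set Ioo_ae_eq_Ioc

omit [NormedSpace ℝ E] in
theorem intervalIntegrable_of_timeVol {T : ℝ} (hT : 0 < T) {f : ℝ → E}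
    (hf : Integrable f (timeVol T)) : IntervalIntegrable f volume 0 T := by
  rw [intervalIntegrable_iff_integrableOn_Ioc_of_le hT.le, IntegrableOn, ← restrict_Ioo_eq_Ioc]
  exact hf

variable [CompleteSpace E]

/-- The fundamental theorem of calculus for vector valued absolutely continuous functions. -/
theorem integral_eq_sub_of_absolutelyContinuous {f f' : ℝ → E} {a b : ℝ}
    (hf : AbsolutelyContinuousOnInterval f a b) (hf' : IntervalIntegrable f' volume a b)
    (hd : ∀ᵐ x, x ∈ uIcc a b → HasDerivAt f (f' x) x) :
    ∀ x ∈ uIcc a b, ∫ t in a..x, f' t = f x - f a := by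
  -- The difference of `f` and the primitive of `f'` is absolutely continuous with derivative zero
  -- almost everywhere, hence constant.
  have gac := hf.sub (absolutelyContinuousOnInterval_primitive hf')
  have g0 : ∀ᵐ x, x ∈ uIcc a b → HasDerivAt (f - fun x ↦ ∫ t in a..x, f' t) 0 x := by
    filter_upwards [hd, hf'.ae_hasDerivAt_integral] with x h1 h2 hx
    simpa using (h1 hx).sub (h2 hx a (by simp))
  obtain ⟨C, hC⟩ := gac.const_of_ae_hasDerivAt_zero g0
  intro x hx
  have h1 := hC a (by simp)
  have h2 := hC x hx
  simp only [Pi.sub_apply, intervalIntegral.integral_same, sub_zero] at h1 h2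
  rw [h1, ← h2]; abel

omit [CompleteSpace E] in
theorem integral_timeVol {T : ℝ} (hT : 0 < T) (f : ℝ → E) :
    ∫ t, f t ∂(timeVol T) = ∫ t in (0)..T, f t := by
  rw [intervalIntegral.integral_of_le hT.le, timeVol, restrict_Ioo_eq_Ioc]

theorem ae_Icc_of_timeVol {T : ℝ} {p : ℝ → Prop} (h : ∀ᵐ t ∂(timeVol T), p t) :
    ∀ᵐ t : ℝ, t ∈ Icc 0 T → p t := by
  rw [ae_restrict_iff' measurableSet_Ioo] at h
  have h0 : ∀ᵐ x : ℝ, x ≠ 0 := by simp [ae_iff, measure_singleton]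
  have h1 : ∀ᵐ x : ℝ, x ≠ T := by simp [ae_iff, measure_singleton]
  filter_upwards [h, h0, h1] with t h h0 h1 ht
  exact h ⟨lt_of_le_of_ne ht.1 h0.symm, lt_of_le_of_ne ht.2 h1⟩

/-- A primitive has its integrand as weak derivative. -/
theorem hasWeakTimeDeriv_primitive {T : ℝ} (hT : 0 < T) {u v : ℝ → E} {x : E}
    (hv : Integrable v (timeVol T)) (hu : ∀ᵐ t ∂(timeVol T), u t = x + ∫ s in (0)..t, v s) :
    HasWeakTimeDeriv T u v := by
  intro φ
  have hvi := intervalIntegrable_of_timeVol hT hv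
  have hPac : AbsolutelyContinuousOnInterval (fun t ↦ x + ∫ s in (0)..t, v s) 0 T :=
    ((LipschitzWith.const x).lipschitzOnWith.absolutelyContinuousOnInterval (K := 0)).fun_add
      (absolutelyContinuousOnInterval_primitive hvi)
  have hφs : ContDiff ℝ ∞ φ := φ.contDiff
  have hφac : AbsolutelyContinuousOnInterval φ 0 T :=
    ((hφs.of_le (by simp)).contDiffOn).absolutelyContinuousOnInterval
  have hφc : Continuous (deriv φ) := hφs.continuous_deriv (by simp)
  have i1 : IntervalIntegrable (fun t ↦ deriv φ t • (x + ∫ s in (0)..t, v s)) volume 0 T :=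
    (hφc.continuousOn.smul hPac.continuousOn).intervalIntegrable
  have i2 : IntervalIntegrable (fun t ↦ φ t • v t) volume 0 T :=
    hvi.continuousOn_smul φ.continuous.continuousOn
  -- Integration by parts: the fundamental theorem for `φ` times the primitive, whose boundary terms
  -- vanish because `φ` is supported inside (0, T).
  have key := integral_eq_sub_of_absolutelyContinuous (hφac.fun_smul hPac) (i2.add i1) (by
    filter_upwards [hvi.ae_hasDerivAt_integral] with t h1 ht
    have hd : HasDerivAt φ (deriv φ t) t := (hφs.differentiable (by simp) t).hasDerivAt
    exact hd.smul ((h1 ht 0 (by simp)).const_add x)) T (by simp)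
  have hφ0 : φ 0 = 0 := image_eq_zero_of_notMem_tsupport fun h ↦ by
    have := φ.tsupport_subset h
    simp [timeInterval] at this
  have hφT : φ T = 0 := image_eq_zero_of_notMem_tsupport fun h ↦ by
    have := φ.tsupport_subset h
    simp [timeInterval] at this
  rw [hφ0, hφT, zero_smul, zero_smul, sub_zero] at key
  rw [intervalIntegral.integral_add i2 i1] at key
  rw [integral_timeVol hT (fun t ↦ φ t • v t), ← eq_neg_of_add_eq_zero_right key,
    ← integral_timeVol hT]
  refine integral_congr_ae ?_
  filter_upwards [hu] with t ht
  rw [ht]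

/-- A locally integrable function with vanishing weak derivative is constant. -/
theorem ae_const_of_hasWeakTimeDeriv_zero {T : ℝ} (hT : 0 < T) {h : ℝ → E}
    (hh : Integrable h (timeVol T))
    (hw : ∀ φ : 𝓓(timeInterval T, ℝ), ∫ t, deriv φ t • h t ∂(timeVol T) = 0) :
    ∃ k : E, ∀ᵐ t ∂(timeVol T), h t = k := by
  -- Du Bois-Reymond's lemma: with a fixed bump `e` of integral one inside (0, T), the constant must
  -- be the `e`-weighted mean of `h`.
  obtain ⟨η, hηd⟩ : ∃ η : ContDiffBump (T / 2 : ℝ), η.rOut = T / 4 :=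
    ⟨⟨T / 8, T / 4, by linarith, by linarith⟩, rfl⟩
  set e : ℝ → ℝ := η.normed volume with he
  have hes : ContDiff ℝ ∞ e := η.contDiff_normed
  have hei : ∫ t, e t = 1 := η.integral_normed
  have hets : tsupport e ⊆ Icc (T / 4) (3 * T / 4) := by
    rw [he, η.tsupport_normed_eq, hηd, Real.closedBall_eq_Icc]
    apply Icc_subset_Icc <;> linarith
  have hec : HasCompactSupport e := η.hasCompactSupport_normed
  refine ⟨∫ t, e t • h t ∂(timeVol T), ?_⟩
  set k := ∫ t, e t • h t ∂(timeVol T)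
  rw [ae_restrict_iff' measurableSet_Ioo]
  have hloc : LocallyIntegrableOn (fun t ↦ h t - k) (Ioo 0 T) volume :=
    IntegrableOn.locallyIntegrableOn (hh.sub (integrable_const k))
  have := isOpen_Ioo.ae_eq_zero_of_integral_contDiff_smul_eq_zero hloc (fun g hg hgc hgs ↦ ?_)
  · filter_upwards [this] with t ht hm
    exact sub_eq_zero.1 (ht hm)
  set m := ∫ t, g t with hm
  -- Removing the mean makes `p` integrate to zero, so its primitive `q` is again compactly
  -- supported and is an admissible test function with derivative `p`. Testing `h` with it gives ∫
  -- g(h − k) = ∫ p h = 0.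
  set p : ℝ → ℝ := fun t ↦ g t - m * e t with hp
  have hps : ContDiff ℝ ∞ p := hg.sub (contDiff_const.mul hes)
  have hpc : HasCompactSupport p := by
    exact hgc.sub (hec.mul_left)
  have hpsub : tsupport p ⊆ Ioo 0 T := by
    have h1 : tsupport p ⊆ tsupport g ∪ tsupport e := by
      refine closure_minimal ?_ ((isClosed_tsupport _).union (isClosed_tsupport _))
      intro t ht
      by_contra hcon
      simp only [mem_union, not_or] at hcon
      refine ht ?_
      simp [hp, image_eq_zero_of_notMem_tsupport hcon.1, image_eq_zero_of_notMem_tsupport hcon.2]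
    refine h1.trans (union_subset hgs (hets.trans ?_))
    intro t ht
    exact ⟨by linarith [ht.1], by linarith [ht.2]⟩
  have hgi : Integrable g := hg.continuous.integrable_of_hasCompactSupport hgc
  have hei' : Integrable e := hes.continuous.integrable_of_hasCompactSupport hec
  have hpint : ∫ t, p t = 0 := by
    simp only [hp]
    rw [integral_sub hgi (hei'.const_mul m), integral_const_mul, hei]
    simp [hm]
  set q : ℝ → ℝ := fun t ↦ ∫ s in (0)..t, p s with hq
  have hqd : ∀ t, HasDerivAt q (p t) t := fun t ↦
    intervalIntegral.integral_hasDerivAt_right (hps.continuous.intervalIntegrable _ _)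
      hps.continuous.stronglyMeasurable.stronglyMeasurableAtFilter hps.continuous.continuousAt
  have hqdf : deriv q = p := funext fun t ↦ (hqd t).deriv
  have hqs : ContDiff ℝ ∞ q := by
    rw [contDiff_infty_iff_deriv, hqdf]
    exact ⟨fun t ↦ (hqd t).differentiableAt, hps⟩
  -- The support of `q` must stay away from 0 and T; compactness of the support of `p` gives the
  -- margin. If that support is empty, any interior point serves.
  obtain ⟨a, b, ha, hb, hab⟩ : ∃ a b : ℝ, 0 < a ∧ b < T ∧ tsupport p ⊆ Icc a b := by
    rcases (tsupport p).eq_empty_or_nonempty with h0 | hne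
    · exact ⟨T / 2, T / 2, by linarith, by linarith, by simp [h0]⟩
    · have hcp : IsCompact (tsupport p) := hpc
      obtain ⟨x, hx⟩ := hcp.exists_isLeast hne
      obtain ⟨y, hy⟩ := hcp.exists_isGreatest hne
      exact ⟨x, y, (hpsub hx.1).1, (hpsub hy.1).2, fun z hz ↦ ⟨hx.2 hz, hy.2 hz⟩⟩
  have hp0 : ∀ t, t ∉ Icc a b → p t = 0 := fun t ht ↦
    image_eq_zero_of_notMem_tsupport fun h ↦ ht (hab h)
  have hq0 : ∀ t, t ∉ Icc a b → q t = 0 := by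
    intro t ht
    rcases lt_or_ge t a with hta | hta
    · refine intervalIntegral.integral_zero_ae (.of_forall fun s hs ↦ hp0 s fun hs' ↦ ?_)
      rcases le_total 0 t with h0t | h0t
      · rw [uIoc_of_le h0t] at hs; linarith [hs.2, hs'.1]
      · rw [uIoc_of_ge h0t] at hs; linarith [hs.2, hs'.1]
    · have htb : b < t := by
        by_contra hcon
        exact ht ⟨hta, not_lt.1 hcon⟩
      rw [hq]
      change ∫ s in (0)..t, p s = 0
      rw [intervalIntegral.integral_of_le (by linarith), setIntegral_eq_integral_of_forall_compl_eq_zero,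
        hpint]
      intro s hs
      refine hp0 s fun hs' ↦ hs ⟨by linarith [hs'.1], by linarith [hs'.2]⟩
  have hqts : tsupport q ⊆ Icc a b :=
    closure_minimal (fun t ht ↦ by_contra fun hcon ↦ ht (hq0 t hcon)) isClosed_Icc
  have hqc : HasCompactSupport q := isCompact_Icc.of_isClosed_subset (isClosed_tsupport _) hqts
  have hmain := hw ⟨q, hqs, hqc, hqts.trans fun t ht ↦ ⟨by linarith [ht.1], by linarith [ht.2]⟩⟩
  have hmain' : ∫ t, p t • h t ∂(timeVol T) = 0 := by rw [← hqdf]; exact hmain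
  have bint : ∀ {w : ℝ → ℝ}, ContDiff ℝ ∞ w → HasCompactSupport w →
      Integrable (fun t ↦ w t • h t) (timeVol T) := by
    intro w hw hwc
    obtain ⟨C, hC⟩ := hwc.exists_bound_of_continuous hw.continuous
    exact hh.bdd_smul C hw.continuous.aestronglyMeasurable (.of_forall hC)
  have e1 : ∫ t, p t • h t ∂(timeVol T) = ∫ t, g t • h t ∂(timeVol T) - m • k := by
    simp only [hp, sub_smul, mul_smul]
    rw [integral_sub (bint hg hgc) ((bint hes hec).fun_smul m), integral_smul]
  have e2 : ∫ t, g t • (h t - k) ∂(timeVol T) = ∫ t, g t • h t ∂(timeVol T) - m • k := by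
    simp only [smul_sub]
    rw [integral_sub (bint hg hgc) (hgi.restrict.smul_const k), integral_smul_const]
    congr 2
    exact setIntegral_eq_integral_of_forall_compl_eq_zero fun t ht ↦
      image_eq_zero_of_notMem_tsupport fun h ↦ ht (hgs h)
  rw [← setIntegral_eq_integral_of_forall_compl_eq_zero (s := Ioo 0 T)]
  · rw [e2, ← e1, hmain']
  · intro t ht
    rw [image_eq_zero_of_notMem_tsupport fun h ↦ ht (hgs h), zero_smul]

/-- The continuous representative of a function with integrable weak derivative is the primitive
of that derivative. -/
theorem eq_primitive_of_hasWeakTimeDeriv {T : ℝ} (hT : 0 < T) {u v w : ℝ → E}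
    (hv : Integrable v (timeVol T)) (huv : HasWeakTimeDeriv T u v)
    (hw : ContinuousOn w (Icc 0 T)) (huw : u =ᵐ[timeVol T] w) :
    ∀ t ∈ Icc 0 T, w t = w 0 + ∫ s in (0)..t, v s := by
  have hvi := intervalIntegrable_of_timeVol hT hv
  have hPc : ContinuousOn (fun t ↦ ∫ s in (0)..t, v s) (Icc 0 T) := by
    rw [← uIcc_of_le hT.le]
    exact (absolutelyContinuousOnInterval_primitive hvi).continuousOn
  have hP := hasWeakTimeDeriv_primitive (x := 0) hT hv (u := fun t ↦ ∫ s in (0)..t, v s)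
    (.of_forall fun t ↦ by simp)
  have hcont : ContinuousOn (fun t ↦ w t - ∫ s in (0)..t, v s) (Icc 0 T) := hw.sub hPc
  have hint : ∀ {g : ℝ → E}, ContinuousOn g (Icc 0 T) → Integrable g (timeVol T) := fun hg ↦
    hg.integrableOn_Icc.mono_set Ioo_subset_Icc_self
  -- The representative and the primitive have the same weak derivative, so their difference is
  -- constant, at first almost everywhere and then by continuity on all of [0, T].
  obtain ⟨k, hk⟩ := ae_const_of_hasWeakTimeDeriv_zero hT (hint hcont) (fun φ ↦ by
    have hφs : ContDiff ℝ ∞ φ := φ.contDiff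
    have hφc : Continuous (deriv φ) := hφs.continuous_deriv (by simp)
    simp only [smul_sub]
    rw [integral_sub (hint (hφc.continuousOn.fun_smul hw)) (hint (hφc.continuousOn.fun_smul hPc)), hP φ,
      ← huv φ, sub_eq_zero]
    refine integral_congr_ae ?_
    filter_upwards [huw] with t ht
    rw [ht])
  have hall : EqOn (fun t ↦ w t - ∫ s in (0)..t, v s) (fun _ ↦ k) (Icc 0 T) := by
    refine Measure.eqOn_Icc_of_ae_eq volume hT.ne ?_ hcont continuousOn_const
    rw [← Measure.restrict_congr_set (Ioo_ae_eq_Icc (μ := volume) (a := (0 : ℝ)) (b := T))]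
    exact hk
  intro t ht
  have h0 : w 0 = k := by simpa using hall (left_mem_Icc.2 hT.le)
  have h1 : w t - ∫ s in (0)..t, v s = k := hall ht
  rw [h0, ← h1, sub_add_cancel]

end TimeCalculus

/-! ### Linear differential equations with measurable coefficients. -/

section LinearODE

open scoped NNReal

/-- Carathéodory's existence theorem for a right-hand side which is integrable in time and
Lipschitz in space. -/
theorem exists_caratheodory {Z : Type*} [NormedAddCommGroup Z] [NormedSpace ℝ Z]
    [CompleteSpace Z] {T : ℝ} (hT : 0 < T) {G : ℝ → Z → Z} {L : ℝ≥0}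
    (hL : ∀ᵐ t ∂(timeVol T), LipschitzWith L (G t))
    (hG : ∀ y : ℝ → Z, Continuous y → Integrable (fun t ↦ G t (y t)) (timeVol T)) (y₀ : Z) :
    ∃ y : ℝ → Z, Continuous y ∧ ∀ t ∈ Icc 0 T, y t = y₀ + ∫ s in (0)..t, G s (y s) := by
  -- Exponential weight: the unknown is z(t) = exp(−l t) y(t). The integral operator then contracts
  -- by L / l = L / (L + 1) < 1 on the whole interval, however large T is.
  set l : ℝ := L + 1 with hl
  have hl0 : 0 < l := by positivity
  let ext : C(Icc 0 T, Z) → ℝ → Z := fun z t ↦ Real.exp (l * t) • IccExtend hT.le z t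
  have hext : ∀ z, Continuous (ext z) := fun z ↦ by
    have := z.continuous.Icc_extend' (h := hT.le)
    fun_prop
  have hint : ∀ z, IntervalIntegrable (fun s ↦ G s (ext z s)) volume 0 T := fun z ↦
    intervalIntegrable_of_timeVol hT (hG _ (hext z))
  have hPc : ∀ z, Continuous fun t : Icc (0 : ℝ) T ↦ ∫ s in (0)..(t : ℝ), G s (ext z s) := by
    intro z
    have := (absolutelyContinuousOnInterval_primitive (hint z)).continuousOn
    rw [uIcc_of_le hT.le] at this
    exact continuousOn_iff_continuous_domRestrict.1 this
  let Φ : C(Icc 0 T, Z) → C(Icc 0 T, Z) := fun z ↦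
    ⟨fun t ↦ Real.exp (-(l * t)) • (y₀ + ∫ s in (0)..(t : ℝ), G s (ext z s)), by
      have := hPc z
      fun_prop⟩
  have hsub : ∀ {t : ℝ}, t ∈ Icc 0 T → ∀ z, IntervalIntegrable (fun s ↦ G s (ext z s)) volume 0 t :=
    fun ht z ↦ (hint z).mono_set (uIcc_subset_uIcc_left (by rwa [uIcc_of_le hT.le]))
  have hcontr : ContractingWith (L / (L + 1)) Φ := by
    refine ⟨?_, LipschitzWith.of_dist_le_mul fun z z' ↦ ?_⟩
    · rw [div_lt_one (by positivity)]; exact lt_add_one L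
    refine (ContinuousMap.dist_le (by positivity)).2 fun t ↦ ?_
    have ht := t.2
    change dist (Real.exp (-(l * t)) • (y₀ + ∫ s in (0)..(t : ℝ), G s (ext z s)))
      (Real.exp (-(l * t)) • (y₀ + ∫ s in (0)..(t : ℝ), G s (ext z' s))) ≤ _
    rw [dist_eq_norm, ← smul_sub, add_sub_add_left_eq_sub,
      ← intervalIntegral.integral_sub (hsub ht z) (hsub ht z'), norm_smul, Real.norm_eq_abs,
      Real.abs_exp]
    have hb : ‖∫ s in (0)..(t : ℝ), (G s (ext z s) - G s (ext z' s))‖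
        ≤ ∫ s in (0)..(t : ℝ), (L * dist z z') * Real.exp (l * s) := by
      refine intervalIntegral.norm_integral_le_of_norm_le ht.1 ?_
        (Continuous.intervalIntegrable (by fun_prop) _ _)
      filter_upwards [ae_Icc_of_timeVol hL] with s hs hst
      have hsI : s ∈ Icc 0 T := ⟨hst.1.le, hst.2.trans ht.2⟩
      rw [← dist_eq_norm]
      refine ((hs hsI).dist_le_mul _ _).trans ?_
      rw [mul_assoc]
      refine mul_le_mul_of_nonneg_left ?_ L.2
      change dist (Real.exp (l * s) • _) (Real.exp (l * s) • _) ≤ _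
      rw [dist_smul₀, Real.norm_eq_abs, Real.abs_exp, mul_comm, IccExtend_of_mem _ _ hsI,
        IccExtend_of_mem _ _ hsI]
      exact mul_le_mul_of_nonneg_right (ContinuousMap.dist_apply_le_dist _) (Real.exp_pos _).le
    have hexp : ∫ s in (0)..(t : ℝ), Real.exp (l * s) = (Real.exp (l * t) - 1) / l := by
      rw [intervalIntegral.integral_comp_mul_left (fun x ↦ Real.exp x) hl0.ne', integral_exp]
      simp [div_eq_inv_mul]
    rw [intervalIntegral.integral_const_mul, hexp] at hb
    calc _ ≤ Real.exp (-(l * t)) * (L * dist z z' * ((Real.exp (l * t) - 1) / l)) := by gcongr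
      _ = (L / l) * dist z z' * (1 - Real.exp (-(l * t))) := by
        have : Real.exp (-(l * t)) * Real.exp (l * t) = 1 := by rw [← Real.exp_add]; simp
        field_simp
        linear_combination (L * dist z z') * this
      _ ≤ (L / l) * dist z z' * 1 := by
        gcongr
        linarith [Real.exp_pos (-(l * t))]
      _ = _ := by rw [mul_one, hl]; norm_cast
  have : Nonempty (C(Icc 0 T, Z)) := ⟨0⟩
  refine ⟨ext hcontr.fixedPoint, hext _, fun t ht ↦ ?_⟩
  have hfix := congrArg (fun z : C(Icc 0 T, Z) ↦ z ⟨t, ht⟩) hcontr.fixedPoint_isFixedPt.eq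
  change Real.exp (-(l * t)) • (y₀ + ∫ s in (0)..t, G s (ext hcontr.fixedPoint s)) = _ at hfix
  change Real.exp (l * t) • IccExtend hT.le hcontr.fixedPoint t = _
  rw [IccExtend_of_mem _ _ ht, ← hfix, smul_smul, ← Real.exp_add]
  simp

variable {X : Type*} [NormedAddCommGroup X] [InnerProductSpace ℝ X] [FiniteDimensional ℝ X]

/-- Inversion is continuous on the open set of units and zero off it, hence Borel. -/
theorem aestronglyMeasurable_ringInverse {α : Type*} [MeasurableSpace α] {μ : Measure α}
    {M : α → X →L[ℝ] X} (hM : AEStronglyMeasurable M μ) :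
    AEStronglyMeasurable (fun t ↦ Ring.inverse (M t)) μ := by
  have hm : Measurable (Ring.inverse : (X →L[ℝ] X) → (X →L[ℝ] X)) := by
    classical
    have h1 : (Ring.inverse : (X →L[ℝ] X) → (X →L[ℝ] X)) =
        {A | IsUnit A}.piecewise Ring.inverse (fun _ ↦ 0) := by
      funext A
      by_cases hA : IsUnit A
      · rw [piecewise_eq_of_mem _ _ _ (show A ∈ {A | IsUnit A} from hA)]
      · rw [piecewise_eq_of_notMem _ _ _ (show A ∉ {A | IsUnit A} from hA),
          Ring.inverse_non_unit _ hA]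
    rw [h1]
    have hc : CompleteSpace X := FiniteDimensional.complete ℝ X
    refine ContinuousOn.measurable_piecewise ?_ continuousOn_const Units.isOpen.measurableSet
    rintro A ⟨A, rfl⟩
    exact (NormedRing.inverse_continuousAt A).continuousWithinAt
  exact (hm.comp_aemeasurable hM.aemeasurable).aestronglyMeasurable

/-- A coercive operator is invertible. -/
theorem isUnit_of_coercive {M : X →L[ℝ] X} {m : ℝ} (hm : 0 < m)
    (h : ∀ v, m * ‖v‖ ^ 2 ≤ inner ℝ (M v) v) : IsUnit M := by
  have hinj : LinearMap.ker (M : X →ₗ[ℝ] X) = ⊥ := by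
    rw [LinearMap.ker_eq_bot']
    intro v hv
    have := h v
    rw [show M v = 0 from hv, inner_zero_left] at this
    have h2 : ‖v‖ ^ 2 ≤ 0 := by
      by_contra hcon
      nlinarith [not_le.1 hcon]
    simpa using h2
  have hu : IsUnit (M : X →ₗ[ℝ] X) := (LinearMap.isUnit_iff_ker_eq_bot _).2 hinj
  let e := (Module.End.isUnit_iff _).1 hu
  let e' := (LinearEquiv.ofBijective (M : X →ₗ[ℝ] X) e).toContinuousLinearEquiv
  have hc : CompleteSpace X := FiniteDimensional.complete ℝ X
  refine ⟨⟨M, e'.symm, ?_, ?_⟩, rfl⟩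
  · ext v; exact e'.apply_symm_apply v
  · ext v; exact e'.symm_apply_apply v

/-- Coercivity at v = M⁻¹w gives m‖v‖² ≤ ‖w‖‖v‖. The bound is uniform in time when m is, which makes
the ODE below uniformly Lipschitz. -/
theorem norm_ringInverse_apply_le {M : X →L[ℝ] X} {m : ℝ} (hm : 0 < m)
    (h : ∀ v, m * ‖v‖ ^ 2 ≤ inner ℝ (M v) v) (w : X) : ‖Ring.inverse M w‖ ≤ m⁻¹ * ‖w‖ := by
  set v := Ring.inverse M w with hv
  have hMv : M v = w := by
    have := Ring.mul_inverse_cancel M (isUnit_of_coercive hm h)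
    exact congrArg (fun A : X →L[ℝ] X ↦ A w) this
  have h1 := (h v).trans (real_inner_le_norm _ _)
  rw [hMv] at h1
  rcases (norm_nonneg v).eq_or_lt with h0 | h0
  · rw [← h0]; positivity
  · rw [inv_mul_eq_div, le_div_iff₀ hm]
    nlinarith

/-- Solvability of `M z + K₁ v + K₀ u = r`, `v = u'`, `z = v'` with measurable coefficients and
coercive leading coefficient. -/
theorem exists_secondOrder {T : ℝ} (hT : 0 < T) {M K₁ : ℝ → X →L[ℝ] X} {r : ℝ → X} {m k : ℝ}
    (K₀ : X →L[ℝ] X) (hM : AEStronglyMeasurable M (timeVol T))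
    (hK : AEStronglyMeasurable K₁ (timeVol T)) (hm : 0 < m) (hk : 0 ≤ k)
    (hcoer : ∀ᵐ t ∂(timeVol T), ∀ v, m * ‖v‖ ^ 2 ≤ inner ℝ (M t v) v)
    (hbd : ∀ᵐ t ∂(timeVol T), ∀ v, ‖K₁ t v‖ ≤ k * ‖v‖) (hr : MemLp r 2 (timeVol T)) (u₀ u₁ : X) :
    ∃ u v z : ℝ → X, Continuous u ∧ Continuous v ∧ MemLp z 2 (timeVol T) ∧
      (∀ t ∈ Icc 0 T, u t = u₀ + ∫ s in (0)..t, v s) ∧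
      (∀ t ∈ Icc 0 T, v t = u₁ + ∫ s in (0)..t, z s) ∧
      ∀ᵐ t ∂(timeVol T), M t (z t) + K₁ t (v t) + K₀ (u t) = r t := by
  have hc : CompleteSpace X := FiniteDimensional.complete ℝ X
  set N : ℝ → X →L[ℝ] X := fun t ↦ Ring.inverse (M t) with hN
  have hNm : AEStronglyMeasurable N (timeVol T) := aestronglyMeasurable_ringInverse hM
  have hNb : ∀ᵐ t ∂(timeVol T), ∀ w, ‖N t w‖ ≤ m⁻¹ * ‖w‖ := by
    filter_upwards [hcoer] with t ht w using norm_ringInverse_apply_le hm ht w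
  -- The equation solved for the second derivative, as a function of the state y = (u, u').
  set Q : ℝ → X × X → X := fun t y ↦ N t (r t - K₀ y.1 - K₁ t y.2) with hQ
  set κ : ℝ := ‖K₀‖ + k with hκ
  have hκ0 : 0 ≤ κ := by positivity
  have hlin : ∀ᵐ t ∂(timeVol T), ∀ y : X × X, ‖K₀ y.1 + K₁ t y.2‖ ≤ κ * ‖y‖ := by
    filter_upwards [hbd] with t ht y
    calc _ ≤ ‖K₀ y.1‖ + ‖K₁ t y.2‖ := norm_add_le _ _
      _ ≤ ‖K₀‖ * ‖y.1‖ + k * ‖y.2‖ := add_le_add (K₀.le_opNorm _) (ht _)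
      _ ≤ ‖K₀‖ * ‖y‖ + k * ‖y‖ := by
        gcongr
        exacts [norm_fst_le y, norm_snd_le y]
      _ = _ := by rw [hκ]; ring
  have hQb : ∀ y : ℝ → X × X, Continuous y → MemLp (fun t ↦ Q t (y t)) 2 (timeVol T) := by
    intro y hy
    obtain ⟨C, hC⟩ := (isCompact_Icc (a := (0 : ℝ)) (b := T)).exists_bound_of_continuousOn
      hy.continuousOn
    have hmeas : AEStronglyMeasurable (fun t ↦ Q t (y t)) (timeVol T) := by
      have happ : ∀ {A : ℝ → X →L[ℝ] X} {w : ℝ → X}, AEStronglyMeasurable A (timeVol T) →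
          AEStronglyMeasurable w (timeVol T) →
          AEStronglyMeasurable (fun t ↦ A t (w t)) (timeVol T) := fun hA hw ↦
        isBoundedBilinearMap_apply.continuous.comp_aestronglyMeasurable (hA.prodMk hw)
      exact happ hNm ((hr.aestronglyMeasurable.sub
        (K₀.continuous.comp hy.fst).aestronglyMeasurable).sub
        (happ hK hy.snd.aestronglyMeasurable))
    have hdom : MemLp (fun t ↦ m⁻¹ * (‖r t‖ + κ * C)) 2 (timeVol T) :=
      (hr.norm.add (memLp_const (κ * C))).const_mul m⁻¹
    refine hdom.mono' hmeas ?_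
    filter_upwards [hNb, hlin, ae_restrict_mem measurableSet_Ioo] with t h1 h2 ht
    refine (h1 _).trans ?_
    gcongr
    rw [sub_sub]
    refine (norm_sub_le _ _).trans ?_
    gcongr
    refine (h2 (y t)).trans ?_
    gcongr
    exact hC t (Ioo_subset_Icc_self ht)
  set G : ℝ → X × X → X × X := fun t y ↦ (y.2, Q t y) with hG
  -- The product carries the maximum norm: the component u' is 1-Lipschitz in the state, and `Q` is
  -- Lipschitz with constant m⁻¹κ.
  set L : ℝ≥0 := max 1 (m⁻¹ * κ).toNNReal with hL
  have hLip : ∀ᵐ t ∂(timeVol T), LipschitzWith L (G t) := by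
    filter_upwards [hNb, hlin] with t h1 h2
    refine (LipschitzWith.prod_snd).prodMk (LipschitzWith.of_dist_le_mul fun y y' ↦ ?_)
    rw [dist_eq_norm, dist_eq_norm, Real.coe_toNNReal _ (by positivity), hQ]
    simp only
    rw [← map_sub, mul_assoc]
    refine (h1 _).trans ?_
    gcongr
    rw [← norm_neg]
    refine le_trans (le_of_eq ?_) (h2 (y - y'))
    rw [Prod.fst_sub, Prod.snd_sub, map_sub, map_sub]
    congr 1
    abel
  obtain ⟨y, hyc, hy⟩ := exists_caratheodory hT hLip (fun y hy ↦ by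
    refine Integrable.prodMk ?_ ((hQb y hy).integrable (by norm_num))
    exact (hy.snd.continuousOn.integrableOn_Icc (a := 0) (b := T)).mono_set Ioo_subset_Icc_self)
    (u₀, u₁)
  have hint : IntervalIntegrable (fun s ↦ G s (y s)) volume 0 T := by
    refine intervalIntegrable_of_timeVol hT (Integrable.prodMk ?_ ((hQb y hyc).integrable (by norm_num)))
    exact (hyc.snd.continuousOn.integrableOn_Icc (a := 0) (b := T)).mono_set Ioo_subset_Icc_self
  have hsub : ∀ {t : ℝ}, t ∈ Icc 0 T → IntervalIntegrable (fun s ↦ G s (y s)) volume 0 t :=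
    fun ht ↦ hint.mono_set (uIcc_subset_uIcc_left (by rwa [uIcc_of_le hT.le]))
  refine ⟨fun t ↦ (y t).1, fun t ↦ (y t).2, fun t ↦ Q t (y t), hyc.fst, hyc.snd, hQb y hyc,
    fun t ht ↦ ?_, fun t ht ↦ ?_, ?_⟩
  · have := ((ContinuousLinearMap.fst ℝ X X).intervalIntegral_comp_comm (hsub ht))
    have h2 := congrArg Prod.fst (hy t ht)
    simp only [ContinuousLinearMap.coe_fst'] at this
    exact h2.trans (by rw [Prod.fst_add, ← this])
  · have := ((ContinuousLinearMap.snd ℝ X X).intervalIntegral_comp_comm (hsub ht))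
    have h2 := congrArg Prod.snd (hy t ht)
    simp only [ContinuousLinearMap.coe_snd'] at this
    exact h2.trans (by rw [Prod.snd_add, ← this])
  · filter_upwards [hcoer] with t ht
    have hMN : M t * N t = 1 := Ring.mul_inverse_cancel _ (isUnit_of_coercive hm ht)
    have : M t (Q t (y t)) = r t - K₀ (y t).1 - K₁ t (y t).2 :=
      congrArg (fun A : X →L[ℝ] X ↦ A (r t - K₀ (y t).1 - K₁ t (y t).2)) hMN
    rw [this]; abel

end LinearODE

/-! ### The energy inequality and Gronwall's argument. -/

section Energy

/-- Completing the square (bV/2 − γU)². The weight b/4 is half of the b/2 in front of |∇u_t|² in the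
energy, so the other half survives. -/
theorem mul_le_young {b γ U V : ℝ} (hb : 0 < b) :
    γ * (U * V) ≤ b / 4 * V ^ 2 + γ ^ 2 / b * U ^ 2 := by
  have : 0 ≤ (b / 2 * V - γ * U) ^ 2 / b := by positivity
  have e : (b / 2 * V - γ * U) ^ 2 / b = b / 4 * V ^ 2 + γ ^ 2 / b * U ^ 2 - γ * (U * V) := by
    field_simp; ring
  linarith

/-- Here U = |∇u|, V = |∇u_t| and x₂ = γ(∇u, ∇u_t). The indefinite cross term costs b/4 of V² and
γ²/b of U²; `A` exceeds the latter by one, which leaves a full U². -/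
theorem energy_lower {b γ A U V x₂ : ℝ} (hb : 0 < b)
    (hx₂ : |x₂| ≤ γ * (U * V)) (hA : A = γ ^ 2 / b + 1) :
    b / 4 * V ^ 2 + U ^ 2 ≤ b / 2 * V ^ 2 + x₂ + A * U ^ 2 := by
  have h1 : γ * (U * V) ≤ b / 4 * V ^ 2 + γ ^ 2 / b * U ^ 2 := mul_le_young hb
  have h2 := neg_abs_le x₂
  rw [hA]; linarith

/-- Used at time zero, to bound the initial energy by the initial data. -/
theorem energy_upper {b γ A U V x₂ : ℝ} (hb : 0 < b)
    (hx₂ : |x₂| ≤ γ * (U * V)) (hA : A = γ ^ 2 / b + 1) :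
    b / 2 * V ^ 2 + x₂ + A * U ^ 2 ≤ (b + 2 * γ ^ 2 / b + 1) * (U ^ 2 + V ^ 2) := by
  have h1 : γ * (U * V) ≤ b / 4 * V ^ 2 + γ ^ 2 / b * U ^ 2 := mul_le_young hb
  have h2 := le_abs_self x₂
  have h3 : 0 ≤ γ ^ 2 / b := by positivity
  have e : 2 * γ ^ 2 / b = 2 * (γ ^ 2 / b) := by ring
  rw [hA, e]
  nlinarith [sq_nonneg U, sq_nonneg V, mul_nonneg h3 (sq_nonneg U), mul_nonneg h3 (sq_nonneg V),
    mul_nonneg hb.le (sq_nonneg U), mul_nonneg hb.le (sq_nonneg V)]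

/-- The pointwise differential inequality behind the energy estimate. -/
theorem energy_ineq {b γ α₀ N A U V W Z g x₁ x₂ x₃ : ℝ} (hb : 0 < b) (hα : 0 < α₀)
    (hx₃ : |x₃| ≤ U * V) (hx₂ : |x₂| ≤ γ * (U * V)) (hA : A = γ ^ 2 / b + 1)
    (hγ : 0 ≤ γ)
    (h : b * x₁ + W + α₀ * Z ^ 2 ≤ g * Z + N * V * Z) :
    b * x₁ + W + γ * V ^ 2 + 2 * A * x₃ ≤ (g ^ 2 / α₀ - α₀ / 2 * Z ^ 2)
      + (4 * N ^ 2 / (α₀ * b) + 4 * (γ + A) / b + A) * (b / 2 * V ^ 2 + x₂ + A * U ^ 2) := by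
  -- In the application Z = |u_tt|, g = |f|, x₁ = (∇u_t, ∇u_tt), W = γ(∇u, ∇u_tt), x₃ = (∇u, ∇u_t),
  -- and N is S times the norm of β. The left side of the conclusion then bounds the derivative of
  -- the energy from above.
  have hA0 : 0 < A := by rw [hA]; positivity
  have hE : b / 4 * V ^ 2 + U ^ 2 ≤ b / 2 * V ^ 2 + x₂ + A * U ^ 2 := energy_lower hb hx₂ hA
  -- The source and the β term each use a quarter of α₀Z²; the remaining half is the dissipation
  -- kept in the conclusion.
  have h3 : g * Z ≤ g ^ 2 / α₀ + α₀ / 4 * Z ^ 2 := by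
    have := mul_le_young (γ := 1) (U := g) (V := Z) hα
    rw [one_mul, one_pow, one_div_mul_eq_div] at this
    linarith
  have h4 : N * V * Z ≤ N ^ 2 / α₀ * V ^ 2 + α₀ / 4 * Z ^ 2 := by
    have := mul_le_young (γ := N) (U := V) (V := Z) hα
    linarith
  have h5 : 2 * A * x₃ ≤ A * (U ^ 2 + V ^ 2) := by
    have := (le_abs_self x₃).trans hx₃
    nlinarith [sq_nonneg (U - V)]
  have h6 : (4 * N ^ 2 / (α₀ * b) + 4 * (γ + A) / b + A) * (b / 4 * V ^ 2 + U ^ 2)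
      ≤ (4 * N ^ 2 / (α₀ * b) + 4 * (γ + A) / b + A) * (b / 2 * V ^ 2 + x₂ + A * U ^ 2) :=
    mul_le_mul_of_nonneg_left hE (by positivity)
  -- This fixes the Gronwall rate: its first two summands, times b/4, cover the coefficients N²/α₀
  -- and γ + A of V², and the last summand covers A U².
  have h7 : N ^ 2 / α₀ * V ^ 2 + (γ + A) * V ^ 2 + A * U ^ 2
      ≤ (4 * N ^ 2 / (α₀ * b) + 4 * (γ + A) / b + A) * (b / 4 * V ^ 2 + U ^ 2) := by
    have e : (4 * N ^ 2 / (α₀ * b) + 4 * (γ + A) / b + A) * (b / 4 * V ^ 2 + U ^ 2)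
        = N ^ 2 / α₀ * V ^ 2 + (γ + A) * V ^ 2 + A * U ^ 2
          + (A * (b / 4 * V ^ 2) + (4 * N ^ 2 / (α₀ * b) + 4 * (γ + A) / b) * U ^ 2) := by
      field_simp; ring
    have : 0 ≤ A * (b / 4 * V ^ 2) + (4 * N ^ 2 / (α₀ * b) + 4 * (γ + A) / b) * U ^ 2 := by
      positivity
    linarith
  nlinarith

variable {X H H' : Type*} [NormedAddCommGroup X] [NormedSpace ℝ X] [CompleteSpace X]
  [NormedAddCommGroup H] [InnerProductSpace ℝ H]
  [NormedAddCommGroup H'] [InnerProductSpace ℝ H']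

/-- The energy estimate for the strongly damped wave equation, in abstract form: `P` is the
embedding into `L²` and `D` is the gradient. -/
theorem energy_estimate (P : X →L[ℝ] H) (D : X →L[ℝ] H') {T b γ α₀ N : ℝ} (hT : 0 < T)
    (hb : 0 < b) (hγ : 0 ≤ γ) (hα : 0 < α₀) {u v z : ℝ → X} {u₀ v₀ : X} {g : ℝ → ℝ}
    (hvi : Integrable v (timeVol T)) (hzi : Integrable z (timeVol T))
    (hu : ∀ t, u t = u₀ + ∫ s in (0)..t, v s) (hv : ∀ t, v t = v₀ + ∫ s in (0)..t, z s)
    (hz2 : Integrable (fun t ↦ ‖P (z t)‖ ^ 2) (timeVol T))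
    (hg2 : Integrable (fun t ↦ g t ^ 2) (timeVol T))
    (heq : ∀ᵐ t ∂(timeVol T), b * inner ℝ (D (v t)) (D (z t)) + γ * inner ℝ (D (u t)) (D (z t))
      + α₀ * ‖P (z t)‖ ^ 2 ≤ g t * ‖P (z t)‖ + N * ‖D (v t)‖ * ‖P (z t)‖)
    {A κ R : ℝ} (hA : A = γ ^ 2 / b + 1)
    (hκ : κ = 4 * N ^ 2 / (α₀ * b) + 4 * (γ + A) / b + A)
    (hR : R = Real.exp (κ * T) * ((b + 2 * γ ^ 2 / b + 1) * (‖D u₀‖ ^ 2 + ‖D v₀‖ ^ 2)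
      + (∫ t, g t ^ 2 ∂(timeVol T)) / α₀)) :
    (∀ t ∈ Icc 0 T, b / 4 * ‖D (v t)‖ ^ 2 + ‖D (u t)‖ ^ 2 ≤ R) ∧
      ∫ t, ‖P (z t)‖ ^ 2 ∂(timeVol T) ≤ 2 / α₀ * R := by
  have hA0 : 0 < A := by rw [hA]; positivity
  have hκ0 : 0 < κ := by rw [hκ]; positivity
  let Q : X × X → ℝ := fun y ↦ b / 2 * ‖D y.2‖ ^ 2 + γ * inner ℝ (D y.1) (D y.2) + A * ‖D y.1‖ ^ 2
  have hQs : ContDiff ℝ 1 Q := by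
    have h1 : ContDiff ℝ 1 fun y : X × X ↦ D y.1 := D.contDiff.comp contDiff_fst
    have h2 : ContDiff ℝ 1 fun y : X × X ↦ D y.2 := D.contDiff.comp contDiff_snd
    exact ((contDiff_const.mul (h2.norm_sq ℝ)).add (contDiff_const.mul (h1.inner ℝ h2))).add
      (contDiff_const.mul (h1.norm_sq ℝ))
  have hvI := intervalIntegrable_of_timeVol hT hvi
  have hzI := intervalIntegrable_of_timeVol hT hzi
  have hyac : AbsolutelyContinuousOnInterval (fun t ↦ (u t, v t)) 0 T := by
    have h1 : AbsolutelyContinuousOnInterval u 0 T := by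
      rw [funext hu]
      exact ((LipschitzWith.const u₀).lipschitzOnWith.absolutelyContinuousOnInterval
        (K := 0)).fun_add (absolutelyContinuousOnInterval_primitive hvI)
    have h2 : AbsolutelyContinuousOnInterval v 0 T := by
      rw [funext hv]
      exact ((LipschitzWith.const v₀).lipschitzOnWith.absolutelyContinuousOnInterval
        (K := 0)).fun_add (absolutelyContinuousOnInterval_primitive hzI)
    have h3 := (absolutelyContinuousOnInterval_contDiff_comp h1
      (ContinuousLinearMap.inl ℝ X X).contDiff).fun_add
      (absolutelyContinuousOnInterval_contDiff_comp h2 (ContinuousLinearMap.inr ℝ X X).contDiff)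
    simpa using h3
  -- The integrating factor removes κQ from the differential inequality.
  let G : ℝ → ℝ := fun t ↦ Real.exp (-(κ * t)) * Q (u t, v t)
  have hGac : AbsolutelyContinuousOnInterval G 0 T := by
    have h1 : AbsolutelyContinuousOnInterval (fun t ↦ Real.exp (-(κ * t))) 0 T := by
      have : ContDiff ℝ 1 fun t : ℝ ↦ Real.exp (-(κ * t)) := by fun_prop
      exact this.contDiffOn.absolutelyContinuousOnInterval
    have h2 : AbsolutelyContinuousOnInterval (fun t ↦ Q (u t, v t)) 0 T :=
      absolutelyContinuousOnInterval_contDiff_comp (f := fun t ↦ (u t, v t)) (g := Q) hyac hQs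
    exact h1.fun_mul h2
  have hx2 : ∀ t, |γ * inner ℝ (D (u t)) (D (v t))| ≤ γ * (‖D (u t)‖ * ‖D (v t)‖) := fun t ↦ by
    rw [abs_mul, abs_of_nonneg hγ]
    exact mul_le_mul_of_nonneg_left (abs_real_inner_le_norm _ _) hγ
  have hQlow : ∀ t, b / 4 * ‖D (v t)‖ ^ 2 + ‖D (u t)‖ ^ 2 ≤ Q (u t, v t) := fun t ↦
    energy_lower hb (hx2 t) hA
  have hQnn : ∀ t, 0 ≤ Q (u t, v t) := fun t ↦ le_trans (by positivity) (hQlow t)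
  have hder : ∀ᵐ t, t ∈ Icc 0 T → deriv G t ≤ g t ^ 2 / α₀
      - α₀ / 2 * Real.exp (-(κ * T)) * ‖P (z t)‖ ^ 2 := by
    filter_upwards [ae_Icc_of_timeVol heq, hvI.ae_hasDerivAt_integral, hzI.ae_hasDerivAt_integral]
      with t h1 h2 h3 ht
    have htu : t ∈ uIcc 0 T := by rwa [uIcc_of_le hT.le]
    have du : HasDerivAt u (v t) t := by
      rw [funext hu]; exact (h2 htu 0 (by simp)).const_add u₀
    have dv : HasDerivAt v (z t) t := by
      have := (h3 htu 0 (by simp)).const_add v₀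
      rwa [← funext hv] at this
    have dDu : HasDerivAt (fun s ↦ D (u s)) (D (v t)) t := D.hasFDerivAt.comp_hasDerivAt t du
    have dDv : HasDerivAt (fun s ↦ D (v s)) (D (z t)) t := D.hasFDerivAt.comp_hasDerivAt t dv
    have dexp : HasDerivAt (fun s ↦ Real.exp (-(κ * s))) (Real.exp (-(κ * t)) * -κ) t := by
      have h0 : HasDerivAt (fun s ↦ -(κ * s)) (-κ) t := by
        simpa using ((hasDerivAt_id t).const_mul κ).fun_neg
      exact h0.exp
    have dQ : HasDerivAt (fun s ↦ Q (u s, v s)) (b / 2 * (2 * inner ℝ (D (v t)) (D (z t)))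
        + γ * (inner ℝ (D (u t)) (D (z t)) + inner ℝ (D (v t)) (D (v t)))
        + A * (2 * inner ℝ (D (u t)) (D (v t)))) t :=
      ((dDv.norm_sq.const_mul _).add ((dDu.inner ℝ dDv).const_mul γ)).add (dDu.norm_sq.const_mul A)
    have dG : HasDerivAt G _ t := dexp.mul dQ
    rw [dG.deriv, real_inner_self_eq_norm_sq]
    have key := energy_ineq (x₃ := inner ℝ (D (u t)) (D (v t)))
      (W := γ * inner ℝ (D (u t)) (D (z t))) hb hα
      (abs_real_inner_le_norm _ _) (hx2 t) hA hγ (h1 ht)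
    rw [← hκ] at key
    have hQe : Q (u t, v t) = b / 2 * ‖D (v t)‖ ^ 2 + γ * inner ℝ (D (u t)) (D (v t))
      + A * ‖D (u t)‖ ^ 2 := rfl
    rw [← hQe] at key
    -- The weight is replaced by its upper bound 1 on the source and by its lower bound exp(−κT) on
    -- the dissipation, so that both have constant coefficients when integrated.
    have e1 : Real.exp (-(κ * t)) ≤ 1 := by
      rw [Real.exp_le_one_iff]; nlinarith [ht.1]
    have e2 : Real.exp (-(κ * T)) ≤ Real.exp (-(κ * t)) := by
      rw [Real.exp_le_exp]; nlinarith [ht.2]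
    have e0 := Real.exp_pos (-(κ * t))
    have k2 := mul_le_mul_of_nonneg_left key e0.le
    have k3 : Real.exp (-(κ * t)) * (g t ^ 2 / α₀) ≤ g t ^ 2 / α₀ :=
      mul_le_of_le_one_left (by positivity) e1
    have k4 : Real.exp (-(κ * T)) * (α₀ / 2 * ‖P (z t)‖ ^ 2)
        ≤ Real.exp (-(κ * t)) * (α₀ / 2 * ‖P (z t)‖ ^ 2) :=
      mul_le_mul_of_nonneg_right e2 (by positivity)
    linarith
  have hg2I := intervalIntegrable_of_timeVol hT hg2
  have hz2I := intervalIntegrable_of_timeVol hT hz2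
  have hmain : ∀ t ∈ Icc 0 T, G t + α₀ / 2 * Real.exp (-(κ * T)) * ∫ s in (0)..t, ‖P (z s)‖ ^ 2
      ≤ G 0 + (∫ s, g s ^ 2 ∂(timeVol T)) / α₀ := by
    intro t ht
    have hsub : uIcc 0 t ⊆ uIcc 0 T := uIcc_subset_uIcc_left (by rwa [uIcc_of_le hT.le])
    have hftc := (hGac.mono hsub).integral_deriv_eq_sub
    have hg2t := (hg2I.mono_set hsub).div_const α₀
    have hz2t := (hz2I.mono_set hsub).const_mul (α₀ / 2 * Real.exp (-(κ * T)))
    have hle := intervalIntegral.integral_mono_ae_restrict ht.1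
      (hGac.mono hsub).intervalIntegrable_deriv (hg2t.sub hz2t) (by
        rw [Filter.EventuallyLE, ae_restrict_iff' measurableSet_Icc]
        filter_upwards [hder] with s hs hst using hs ⟨hst.1, hst.2.trans ht.2⟩)
    rw [hftc, intervalIntegral.integral_sub hg2t hz2t, intervalIntegral.integral_const_mul,
      intervalIntegral.integral_div] at hle
    have hmono : ∫ s in (0)..t, g s ^ 2 ≤ ∫ s, g s ^ 2 ∂(timeVol T) := by
      rw [integral_timeVol hT]
      exact intervalIntegral.integral_mono_interval le_rfl ht.1 ht.2
        (.of_forall fun s ↦ sq_nonneg _) hg2I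
    have := div_le_div_of_nonneg_right hmono hα.le
    linarith
  have hG0 : G 0 ≤ (b + 2 * γ ^ 2 / b + 1) * (‖D u₀‖ ^ 2 + ‖D v₀‖ ^ 2) := by
    have h1 := energy_upper hb (hx2 0) hA
    have hu0 : u 0 = u₀ := by simpa using hu 0
    have hv0 : v 0 = v₀ := by simpa using hv 0
    have : G 0 = Q (u 0, v 0) := by simp [G]
    rw [this]
    rw [hu0, hv0] at h1 ⊢
    exact h1
  set R₀ := (b + 2 * γ ^ 2 / b + 1) * (‖D u₀‖ ^ 2 + ‖D v₀‖ ^ 2)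
      + (∫ t, g t ^ 2 ∂(timeVol T)) / α₀
  have hmain' : ∀ t ∈ Icc 0 T, G t + α₀ / 2 * Real.exp (-(κ * T)) * ∫ s in (0)..t, ‖P (z s)‖ ^ 2
      ≤ R₀ := fun t ht ↦ (hmain t ht).trans (by simp only [R₀]; linarith)
  have hexp : Real.exp (κ * T) * Real.exp (-(κ * T)) = 1 := by rw [← Real.exp_add]; simp
  have hinn : ∀ t ∈ Icc 0 T, 0 ≤ ∫ s in (0)..t, ‖P (z s)‖ ^ 2 := fun t ht ↦
    intervalIntegral.integral_nonneg ht.1 fun s _ ↦ by positivity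
  constructor
  · intro t ht
    refine (hQlow t).trans ?_
    have e2 : Real.exp (-(κ * T)) ≤ Real.exp (-(κ * t)) := by
      rw [Real.exp_le_exp]; nlinarith [ht.2]
    have h1 : Real.exp (-(κ * T)) * Q (u t, v t) ≤ R₀ := by
      have h2 := hmain' t ht
      have h3 : 0 ≤ α₀ / 2 * Real.exp (-(κ * T)) * ∫ s in (0)..t, ‖P (z s)‖ ^ 2 :=
        mul_nonneg (by positivity) (hinn t ht)
      exact (mul_le_mul_of_nonneg_right e2 (hQnn t)).trans (by linarith)
    calc Q (u t, v t) = Real.exp (κ * T) * (Real.exp (-(κ * T)) * Q (u t, v t)) := by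
          rw [← mul_assoc, hexp, one_mul]
      _ ≤ R := by rw [hR]; gcongr
  · have h2 := hmain' T (right_mem_Icc.2 hT.le)
    have h3 : 0 ≤ G T := mul_nonneg (Real.exp_pos _).le (hQnn T)
    rw [← integral_timeVol hT] at h2
    set J := ∫ t, ‖P (z t)‖ ^ 2 ∂(timeVol T)
    calc J = 2 / α₀ * (Real.exp (κ * T) * (α₀ / 2 * Real.exp (-(κ * T)) * J)) := by
          have : 2 / α₀ * (Real.exp (κ * T) * (α₀ / 2 * Real.exp (-(κ * T)) * J))
            = (Real.exp (κ * T) * Real.exp (-(κ * T))) * J := by field_simp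
          rw [this, hexp, one_mul]
      _ ≤ 2 / α₀ * R := by rw [hR]; gcongr; linarith

end Energy

/-! ### The Sobolev inequality on H₀¹(Ω). -/

section Sobolev

open scoped NNReal

theorem IsConvexPolytope.isBounded {d : ℕ} {Ω : Opens (Space d)} (hΩ : IsConvexPolytope Ω) :
    Bornology.IsBounded (Ω : Set (Space d)) := by
  obtain ⟨-, s, hs⟩ := hΩ
  rw [hs]
  exact (s.finite_toSet.isCompact_convexHull (𝕜 := ℝ)).isBounded.subset interior_subset

/-- The exponent `p ≤ 2` whose Sobolev conjugate is `6` in dimension two or three. -/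
theorem exists_sobolev_exponent {d : ℕ} (hd : d = 2 ∨ d = 3) :
    ∃ p : ℝ≥0, 1 ≤ p ∧ p ≤ 2 ∧
      (((6 : ℝ≥0) : ℝ))⁻¹ = (p : ℝ)⁻¹ - (Module.finrank ℝ (Space d) : ℝ)⁻¹ := by
  rw [finrank_euclideanSpace_fin]
  rcases hd with rfl | rfl
  -- In the plane 1/6 = 2/3 − 1/2, so p = 3/2; in space 1/6 = 1/2 − 1/3, so p = 2. Hölder on the
  -- bounded domain then passes from L^p to L² for the gradient.
  · refine ⟨3 / 2, ?_, ?_, ?_⟩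
    · rw [← NNReal.coe_le_coe]; push_cast; norm_num
    · rw [← NNReal.coe_le_coe]; push_cast; norm_num
    · push_cast; norm_num
  · refine ⟨2, by norm_num, by norm_num, ?_⟩
    push_cast; norm_num

/-- Hölder's inequality on a domain of finite measure. -/
theorem exists_eLpNorm_le_two {d : ℕ} {Ω : Opens (Space d)}
    (hΩ : Bornology.IsBounded (Ω : Set (Space d))) {p : ℝ≥0} (hp1 : 1 ≤ p) (hp2 : p ≤ 2) :
    ∃ m : ℝ≥0, ∀ w : Space d → ℝ, AEStronglyMeasurable w (vol Ω) →
      eLpNorm w p (vol Ω) ≤ eLpNorm w 2 (vol Ω) * m := by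
  have hfin : (vol Ω) univ < ⊤ := by
    rw [Measure.restrict_apply_univ]; exact hΩ.measure_lt_top
  set e : ℝ := 1 / (p : ℝ≥0∞).toReal - 1 / (2 : ℝ≥0∞).toReal
  have he : 0 ≤ e := by
    simp only [e, ENNReal.coe_toReal, ENNReal.toReal_ofNat, sub_nonneg]
    refine one_div_le_one_div_of_le ?_ (by exact_mod_cast hp2)
    exact lt_of_lt_of_le one_pos (by exact_mod_cast hp1)
  have hm : (vol Ω) univ ^ e ≠ ⊤ := ENNReal.rpow_ne_top_of_nonneg he hfin.ne
  refine ⟨((vol Ω) univ ^ e).toNNReal, fun w hw ↦ ?_⟩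
  rw [ENNReal.coe_toNNReal hm]
  exact eLpNorm_le_eLpNorm_mul_rpow_measure_univ (by exact_mod_cast hp2) hw

/-- The Sobolev inequality `|φ|_{L⁶} ≤ S |∇φ|_{L²}` for test functions on a bounded domain of
dimension two or three. -/
theorem exists_sobolev_testFunction {d : ℕ} (hd : d = 2 ∨ d = 3) {Ω : Opens (Space d)}
    (hΩ : Bornology.IsBounded (Ω : Set (Space d))) :
    ∃ S : ℝ≥0, ∀ φ : 𝓓(Ω, ℝ),
      eLpNorm φ 6 (vol Ω) ≤ S * eLpNorm (∇ (φ : Space d → ℝ)) 2 (vol Ω) := by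
  obtain ⟨p, hp1, hp2, hp⟩ := exists_sobolev_exponent hd
  obtain ⟨m, hm⟩ := exists_eLpNorm_le_two hΩ hp1 hp2
  have hn : 0 < Module.finrank ℝ (Space d) := by
    rw [finrank_euclideanSpace_fin]; omega
  obtain ⟨K, hK⟩ : ∃ K : ℝ≥0, K = SNormLESNormFDerivOfEqConst ℝ (volume : Measure (Space d)) p :=
    ⟨_, rfl⟩
  refine ⟨K * m, fun φ ↦ ?_⟩
  have hφs : ContDiff ℝ ∞ φ := φ.contDiff
  have h1 := eLpNorm_le_eLpNorm_fderiv_of_eq (volume : Measure (Space d)) (u := φ)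
    (hφs.of_le (by simp)) φ.hasCompactSupport hp1 hn hp
  obtain ⟨w, hw⟩ : ∃ w : Space d → ℝ, w = fun x ↦ ‖fderiv ℝ φ x‖ := ⟨_, rfl⟩
  have hwc : Continuous w := by rw [hw]; exact (hφs.continuous_fderiv (by simp)).norm
  -- The gradient of a test function lives in Ω, so its norms over Ω and over the whole space agree.
  have hsupp : Function.support w ⊆ (Ω : Set (Space d)) := by
    refine subset_trans ?_ ((subset_tsupport _).trans
      ((tsupport_fderiv_subset ℝ).trans φ.tsupport_subset))
    intro x hx h0
    rw [hw] at hx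
    exact hx (by simp [h0])
  rw [← eLpNorm_norm (fderiv ℝ φ), ← hw, ← hK] at h1
  have h3 : eLpNorm (∇ (φ : Space d → ℝ)) 2 (vol Ω) = eLpNorm w 2 (vol Ω) :=
    eLpNorm_congr_norm_ae (.of_forall fun x ↦ by simp [gradient, hw])
  rw [h3]
  have h4 : eLpNorm φ 6 (vol Ω) ≤ eLpNorm φ ((6 : ℝ≥0) : ℝ≥0∞) volume := by
    simpa using eLpNorm_mono_measure (p := 6) φ Measure.restrict_le_self
  have h5 : eLpNorm w p (vol Ω) = eLpNorm w p volume :=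
    eLpNorm_restrict_eq_of_support_subset hsupp
  calc eLpNorm φ 6 (vol Ω) ≤ K * eLpNorm w p volume := h4.trans h1
    _ ≤ K * (eLpNorm w 2 (vol Ω) * m) := by
        rw [← h5]; gcongr; exact hm w hwc.aestronglyMeasurable
    _ = _ := by rw [ENNReal.coe_mul]; ring

/-- The Sobolev inequality `|u|_{L⁶} ≤ S |∇u|_{L²}` on `H₀¹(Ω)`. -/
theorem exists_sobolev {d : ℕ} (hd : d = 2 ∨ d = 3) {Ω : Opens (Space d)}
    (hΩ : Bornology.IsBounded (Ω : Set (Space d))) :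
    ∃ S : ℝ≥0, ∀ p ∈ H01 Ω, eLpNorm p.fst 6 (vol Ω) ≤ S * ‖p.snd‖ₑ := by
  obtain ⟨S, hS⟩ := exists_sobolev_testFunction hd hΩ
  refine ⟨S, fun p hp ↦ ?_⟩
  have hp' : p ∈ closure ((testPairs Ω : Submodule ℝ (L2Pair Ω)) : Set (L2Pair Ω)) := hp
  obtain ⟨q, hq, hlim⟩ := mem_closure_iff_seq_limit.1 hp'
  have hfst : Filter.Tendsto (fun n ↦ (q n).fst) Filter.atTop (nhds p.fst) :=
    ((WithLp.continuous_fst 2 _ _).tendsto p).comp hlim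
  have hsnd : Filter.Tendsto (fun n ↦ (q n).snd) Filter.atTop (nhds p.snd) :=
    ((WithLp.continuous_snd 2 _ _).tendsto p).comp hlim
  -- L² convergence gives an almost everywhere convergent subsequence, and Fatou's lemma carries the
  -- L⁶ bound to the limit; no convergence in L⁶ is needed.
  obtain ⟨ns, hns, hae⟩ := (tendstoInMeasure_of_tendsto_Lp hfst).exists_seq_tendsto_ae
  have hbound : ∀ n, eLpNorm (q n).fst 6 (vol Ω) ≤ S * ‖(q n).snd‖ₑ := by
    intro n
    obtain ⟨φ, h1, h2⟩ := hq n
    rw [eLpNorm_congr_ae h1, Lp.enorm_def, eLpNorm_congr_ae h2]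
    exact hS φ
  have hlimS : Filter.Tendsto (fun n ↦ (S : ℝ≥0∞) * ‖(q (ns n)).snd‖ₑ) Filter.atTop
      (nhds (S * ‖p.snd‖ₑ)) :=
    ENNReal.Tendsto.const_mul ((hsnd.comp hns.tendsto_atTop).enorm) (Or.inr (by simp))
  calc eLpNorm p.fst 6 (vol Ω)
      ≤ Filter.liminf (fun n ↦ eLpNorm (q (ns n)).fst 6 (vol Ω)) Filter.atTop :=
        Lp.eLpNorm_lim_le_liminf_eLpNorm (fun n ↦ Lp.aestronglyMeasurable _) _ hae
    _ ≤ Filter.liminf (fun n ↦ (S : ℝ≥0∞) * ‖(q (ns n)).snd‖ₑ) Filter.atTop :=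
        Filter.liminf_le_liminf (.of_forall fun n ↦ hbound _)
    _ = _ := hlimS.liminf_eq

end Sobolev

/-! ### Weighted bilinear forms on the finite element space. -/

section Forms

open scoped NNReal

theorem holderTriple_three_six_two : ENNReal.HolderTriple 3 6 2 := by
  refine ⟨?_⟩
  rw [← ENNReal.toReal_eq_toReal_iff' (by simp) (by simp), ENNReal.toReal_add (by simp) (by simp)]
  simp only [ENNReal.toReal_inv, ENNReal.toReal_ofNat]
  norm_num

/-- A measurable family of bilinear forms on a finite-dimensional space is represented by a
measurable family of operators. -/
theorem exists_operator_of_bilin {X : Type*} [NormedAddCommGroup X] [InnerProductSpace ℝ X]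
    [FiniteDimensional ℝ X] {τ : Type*} [MeasurableSpace τ] {μ : Measure τ} {B : τ → X → X → ℝ}
    (hm : ∀ v w, AEStronglyMeasurable (fun t ↦ B t v w) μ)
    (hl : ∀ᵐ t ∂μ, ∃ L : X →ₗ[ℝ] X →ₗ[ℝ] ℝ, ∀ v w, B t v w = L v w) :
    ∃ A : τ → X →L[ℝ] X, AEStronglyMeasurable A μ ∧
      ∀ᵐ t ∂μ, ∀ v w, inner ℝ (A t v) w = B t v w := by
  let e := stdOrthonormalBasis ℝ X
  -- The matrix in an orthonormal basis: its entries are measurable scalars, so the operator is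
  -- measurable without any choice in t.
  refine ⟨fun t ↦ ∑ i, ∑ j, B t (e i) (e j) • (innerSL ℝ (e i)).smulRight (e j), ?_, ?_⟩
  · refine Finset.aestronglyMeasurable_fun_sum _ fun i _ ↦
      Finset.aestronglyMeasurable_fun_sum _ fun j _ ↦ ?_
    exact (hm _ _).smul_const _
  · filter_upwards [hl] with t ⟨L, hL⟩ v w
    rw [hL, ← LinearMap.sum_repr_mul_repr_mul e.toBasis e.toBasis]
    simp only [_root_.sum_apply, _root_.smul_apply,
      ContinuousLinearMap.smulRight_apply, innerSL_apply_apply, sum_inner, inner_smul_left, hL]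
    rw [Finsupp.sum_fintype _ _ (by simp)]
    refine Finset.sum_congr rfl fun i _ ↦ ?_
    rw [Finsupp.sum_fintype _ _ (by simp)]
    refine Finset.sum_congr rfl fun j _ ↦ ?_
    simp only [OrthonormalBasis.coe_toBasis_repr_apply, OrthonormalBasis.repr_apply_apply,
      OrthonormalBasis.coe_toBasis, smul_eq_mul]
    simp
    ring

/-- A measurable family of linear forms on a finite-dimensional space is represented by a
measurable family of vectors. -/
theorem exists_vector_of_linear {X : Type*} [NormedAddCommGroup X] [InnerProductSpace ℝ X]
    [FiniteDimensional ℝ X] {τ : Type*} [MeasurableSpace τ] {μ : Measure τ} {B : τ → X → ℝ}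
    (hm : ∀ w, AEStronglyMeasurable (fun t ↦ B t w) μ)
    (hl : ∀ᵐ t ∂μ, ∃ L : X →ₗ[ℝ] ℝ, ∀ w, B t w = L w) :
    ∃ r : τ → X, AEStronglyMeasurable r μ ∧ ∀ᵐ t ∂μ, ∀ w, inner ℝ (r t) w = B t w := by
  let e := stdOrthonormalBasis ℝ X
  refine ⟨fun t ↦ ∑ i, B t (e i) • e i, ?_, ?_⟩
  · exact Finset.aestronglyMeasurable_fun_sum _ fun i _ ↦ (hm _).smul_const _
  · filter_upwards [hl] with t ⟨L, hL⟩ w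
    conv_rhs => rw [hL, ← e.sum_repr w, map_sum]
    simp only [sum_inner, inner_smul_left, hL, map_smul, OrthonormalBasis.repr_apply_apply,
      smul_eq_mul]
    refine Finset.sum_congr rfl fun i _ ↦ ?_
    simp [mul_comm]

variable {d : ℕ} {Ω : Opens (Space d)} {𝒯 : Triangulation Ω}

/-- The function underlying a finite element, as a continuous linear map. -/
noncomputable def fnL (𝒯 : Triangulation Ω) : femSpace 𝒯 →L[ℝ] Lp ℝ 2 (vol Ω) :=
  LinearMap.toContinuousLinearMap
    { toFun := fn, map_add' := fun _ _ ↦ rfl, map_smul' := fun _ _ ↦ rfl }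

/-- The gradient of a finite element, as a continuous linear map. -/
noncomputable def gradL (𝒯 : Triangulation Ω) : femSpace 𝒯 →L[ℝ] Lp (Space d) 2 (vol Ω) :=
  LinearMap.toContinuousLinearMap
    { toFun := grad, map_add' := fun _ _ ↦ rfl, map_smul' := fun _ _ ↦ rfl }

@[simp] theorem fnL_apply (v : femSpace 𝒯) : fnL 𝒯 v = fn v := rfl

@[simp] theorem gradL_apply (v : femSpace 𝒯) : gradL 𝒯 v = grad v := rfl

theorem eq_zero_of_fn_eq_zero {v : femSpace 𝒯} (h : fn v = 0) : v = 0 :=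
  Subtype.ext (WithLp.ofLp_injective 2 (Prod.ext h (snd_eq_zero v.2.1 h)))

/-- The energy sees `u` and `u_t` only through their gradients; by Sobolev's inequality this
suffices for uniqueness. -/
theorem eq_zero_of_grad_eq_zero {S : ℝ≥0}
    (hS : ∀ p ∈ H01 Ω, eLpNorm p.fst 6 (vol Ω) ≤ S * ‖p.snd‖ₑ) {v : femSpace 𝒯}
    (h : grad v = 0) : v = 0 := by
  refine eq_zero_of_fn_eq_zero ?_
  have h1 := hS v v.2.1
  rw [show (v : L2Pair Ω).snd = 0 from h] at h1
  simp only [enorm_zero, mul_zero, nonpos_iff_eq_zero] at h1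
  rw [Lp.eq_zero_iff_ae_eq_zero]
  exact (eLpNorm_eq_zero_iff (Lp.aestronglyMeasurable _) (by norm_num)).1 h1

theorem integral_mul_eq_inner {w : Space d → ℝ} (hw : MemLp w 2 (vol Ω)) (q : Lp ℝ 2 (vol Ω)) :
    ∫ x, w x * q x ∂(vol Ω) = inner ℝ hw.toLp q := by
  rw [L2.inner_def]
  refine integral_congr_ae ?_
  filter_upwards [hw.coeFn_toLp] with x hx
  rw [hx]
  simp [mul_comm]

theorem abs_integral_mul_le {w : Space d → ℝ} (hw : MemLp w 2 (vol Ω)) (q : Lp ℝ 2 (vol Ω)) :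
    |∫ x, w x * q x ∂(vol Ω)| ≤ (eLpNorm w 2 (vol Ω)).toReal * ‖q‖ := by
  rw [integral_mul_eq_inner hw, ← Lp.norm_toLp w hw]
  exact abs_real_inner_le_norm _ _

/-- The linear form `φ ↦ (w, φ)`. -/
theorem exists_linear_integral_mul (𝒯 : Triangulation Ω) {w : Space d → ℝ}
    (hw : MemLp w 2 (vol Ω)) :
    ∃ L : femSpace 𝒯 →ₗ[ℝ] ℝ, ∀ φ, ∫ x, w x * fn φ x ∂(vol Ω) = L φ :=
  ⟨(innerₛₗ ℝ hw.toLp) ∘ₗ (fnL 𝒯 : femSpace 𝒯 →ₗ[ℝ] Lp ℝ 2 (vol Ω)), fun _ ↦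
    integral_mul_eq_inner hw _⟩

/-- The bilinear form `(v, φ) ↦ (w v, φ)`. -/
theorem exists_bilin_integral_mul {w : Space d → ℝ}
    (hw : ∀ v : femSpace 𝒯, MemLp (fun x ↦ w x * fn v x) 2 (vol Ω)) :
    ∃ L : femSpace 𝒯 →ₗ[ℝ] femSpace 𝒯 →ₗ[ℝ] ℝ, ∀ v φ,
      ∫ x, w x * fn v x * fn φ x ∂(vol Ω) = L v φ := by
  have h0 := fun (v φ : femSpace 𝒯) ↦ integral_mul_eq_inner (hw v) (fn φ)
  have hadd : ∀ v v' : femSpace 𝒯, (hw (v + v')).toLp = (hw v).toLp + (hw v').toLp := by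
    intro v v'
    rw [← MemLp.toLp_add]
    refine MemLp.toLp_congr _ _ ?_
    filter_upwards [Lp.coeFn_add (fn v) (fn v')] with x hx
    change w x * (fn v + fn v') x = _
    rw [hx]; simp [mul_add]
  have hsmul : ∀ (c : ℝ) (v : femSpace 𝒯), (hw (c • v)).toLp = c • (hw v).toLp := by
    intro c v
    rw [← MemLp.toLp_const_smul]
    refine MemLp.toLp_congr _ _ ?_
    filter_upwards [Lp.coeFn_smul c (fn v)] with x hx
    change w x * (c • fn v) x = _
    rw [hx]; simp; ring
  refine ⟨LinearMap.mk₂ ℝ (fun v φ ↦ inner ℝ (hw v).toLp (fnL 𝒯 φ)) ?_ ?_ ?_ ?_, h0⟩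
  · intro v v' φ; rw [hadd, inner_add_left]
  · intro c v φ; rw [hsmul, inner_smul_left]; rfl
  · intro v φ ψ; rw [map_add, inner_add_right]
  · intro c v φ; rw [map_smul, inner_smul_right]; rfl

theorem ae_eLpNorm_le_mixedNorm {T : ℝ} {p : ℝ≥0∞} (g : ℝ → Space d → ℝ) :
    ∀ᵐ t ∂(timeVol T), eLpNorm (g t) p (vol Ω) ≤ mixedNorm T Ω ⊤ p g := by
  have := ae_le_eLpNormEssSup (f := fun t ↦ eLpNorm (g t) p (vol Ω)) (μ := timeVol T)
  simpa [mixedNorm, eLpNorm_exponent_top] using this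

theorem MemMixed.ae_memLp {T : ℝ} {p : ℝ≥0∞} {g : ℝ → Space d → ℝ} (hg : MemMixed T Ω ⊤ p g) :
    ∀ᵐ t ∂(timeVol T), MemLp (g t) p (vol Ω) := by
  filter_upwards [hg.1.prodMk_left, ae_eLpNorm_le_mixedNorm (Ω := Ω) (p := p) g] with t h1 h2
  exact ⟨h1, h2.trans_lt hg.2⟩

/-- The pointwise bound `|(β v, φ)| ≤ S |β|_{L³} |∇v| |φ|`. -/
theorem weight_three {S : ℝ≥0} (hS : ∀ p ∈ H01 Ω, eLpNorm p.fst 6 (vol Ω) ≤ S * ‖p.snd‖ₑ)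
    {w : Space d → ℝ} (hw : MemLp w 3 (vol Ω)) (v : femSpace 𝒯) :
    MemLp (fun x ↦ w x * fn v x) 2 (vol Ω) ∧ (eLpNorm (fun x ↦ w x * fn v x) 2 (vol Ω)).toReal
      ≤ (eLpNorm w 3 (vol Ω)).toReal * (S * ‖grad v‖) := by
  have := holderTriple_three_six_two
  have h6 := hS v v.2.1
  have hv : AEStronglyMeasurable (fn v) (vol Ω) := Lp.aestronglyMeasurable _
  have hle : eLpNorm (fun x ↦ w x * fn v x) 2 (vol Ω)
      ≤ eLpNorm w 3 (vol Ω) * (S * ‖grad v‖ₑ) :=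
    (eLpNorm_smul_le_mul_eLpNorm hv hw.1).trans (mul_le_mul_right h6 _)
  have hfin : eLpNorm w 3 (vol Ω) * (S * ‖grad v‖ₑ) ≠ ⊤ :=
    ENNReal.mul_ne_top hw.2.ne (ENNReal.mul_ne_top (by simp) (by simp))
  refine ⟨⟨hw.1.mul hv, hle.trans_lt hfin.lt_top⟩, ?_⟩
  have := ENNReal.toReal_mono hfin hle
  simpa using this

theorem weight_top {w : Space d → ℝ} (hw : MemLp w ⊤ (vol Ω)) (v : femSpace 𝒯) :
    MemLp (fun x ↦ w x * fn v x) 2 (vol Ω) := by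
  have := ENNReal.HolderTriple.symm (p := 2) (q := ⊤) (r := 2)
  exact (Lp.memLp (fn v)).mul' hw

theorem coercive_weight {α₀ : ℝ} {w : Space d → ℝ} (hw : MemLp w ⊤ (vol Ω))
    (h : ∀ᵐ x ∂(vol Ω), α₀ ≤ w x) (v : femSpace 𝒯) :
    α₀ * ‖fn v‖ ^ 2 ≤ ∫ x, w x * fn v x * fn v x ∂(vol Ω) := by
  have h1 : ‖fn v‖ ^ 2 = ∫ x, fn v x * fn v x ∂(vol Ω) := by
    rw [← real_inner_self_eq_norm_sq, L2.inner_def]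
    simp [pow_two]
  rw [h1, ← integral_const_mul]
  have hv := Lp.memLp (fn v)
  refine integral_mono_ae ((hv.integrable_mul hv).const_mul α₀)
    ((weight_top hw v).integrable_mul hv) ?_
  filter_upwards [h] with x hx
  have := mul_le_mul_of_nonneg_right hx (mul_self_nonneg (fn v x))
  simpa [mul_assoc] using this

theorem aestronglyMeasurable_integral_mul {T : ℝ} {g : ℝ → Space d → ℝ}
    (hg : AEStronglyMeasurable (Function.uncurry g) ((timeVol T).prod (vol Ω)))
    {q : Space d → ℝ} (hq : AEStronglyMeasurable q (vol Ω)) :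
    AEStronglyMeasurable (fun t ↦ ∫ x, g t x * q x ∂(vol Ω)) (timeVol T) :=
  (hg.mul hq.comp_snd).integral_prod_right'

/-- The time-dependent `L²` norm of a function in `L²(0, T; L²(Ω))`. -/
theorem MemMixed.two_two {T : ℝ} {f : ℝ → Space d → ℝ} (hf : MemMixed T Ω 2 2 f) :
    (∀ᵐ t ∂(timeVol T), MemLp (f t) 2 (vol Ω)) ∧
      MemLp (fun t ↦ (eLpNorm (f t) 2 (vol Ω)).toReal) 2 (timeVol T) ∧
      ∫ t, (eLpNorm (f t) 2 (vol Ω)).toReal ^ 2 ∂(timeVol T) = (mixedNorm T Ω 2 2 f).toReal ^ 2 := by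
  have hmeas : AEMeasurable (fun t ↦ eLpNorm (f t) 2 (vol Ω)) (timeVol T) := by
    simp only [eLpNorm_eq_lintegral_rpow_enorm_toReal (p := 2) (by simp) (by simp)]
    exact ((hf.1.enorm.pow_const _).lintegral_prod_right').pow_const _
  have hpow : mixedNorm T Ω 2 2 f ^ 2 = ∫⁻ t, eLpNorm (f t) 2 (vol Ω) ^ 2 ∂(timeVol T) := by
    have := eLpNorm_nnreal_pow_eq_lintegral (μ := timeVol T) (p := 2)
      (f := fun t ↦ eLpNorm (f t) 2 (vol Ω)) (by simp)
    simpa [mixedNorm] using this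
  have hfinint : ∫⁻ t, eLpNorm (f t) 2 (vol Ω) ^ 2 ∂(timeVol T) ≠ ⊤ := by
    rw [← hpow]; exact ENNReal.pow_ne_top hf.2.ne
  -- Slices of infinite norm must be negligible before passing to real numbers, since `toReal` sends
  -- ∞ to 0.
  have hae : ∀ᵐ t ∂(timeVol T), eLpNorm (f t) 2 (vol Ω) < ⊤ := by
    filter_upwards [ae_lt_top' (hmeas.pow_const 2) hfinint] with t ht
    by_contra hcon
    simp [not_lt_top_iff.1 hcon] at ht
  have hnorm : eLpNorm (fun t ↦ (eLpNorm (f t) 2 (vol Ω)).toReal) 2 (timeVol T)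
      = mixedNorm T Ω 2 2 f := by
    refine eLpNorm_congr_enorm_ae ?_
    filter_upwards [hae] with t ht
    rw [Real.enorm_of_nonneg ENNReal.toReal_nonneg, ENNReal.ofReal_toReal ht.ne]
    simp
  refine ⟨?_, ⟨hmeas.ennreal_toReal.aestronglyMeasurable, hnorm ▸ hf.2⟩, ?_⟩
  · filter_upwards [hf.1.prodMk_left, hae] with t h1 h2 using ⟨h1, h2⟩
  · rw [integral_eq_lintegral_of_nonneg_ae (.of_forall fun t ↦ by positivity)
      (hmeas.ennreal_toReal.pow_const 2).aestronglyMeasurable, ← ENNReal.toReal_pow, hpow]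
    congr 1
    refine lintegral_congr_ae ?_
    filter_upwards [hae] with t ht
    rw [ENNReal.ofReal_pow ENNReal.toReal_nonneg, ENNReal.ofReal_toReal ht.ne]

end Forms

/-! ### Existence, energy bound and uniqueness for the semi-discrete problem. -/

section Solutions

open scoped NNReal

theorem intervalIntegral_congr_timeVol {E : Type*} [NormedAddCommGroup E] [NormedSpace ℝ E]
    {T t : ℝ} (ht : t ∈ Icc 0 T) {v w : ℝ → E} (h : v =ᵐ[timeVol T] w) :
    ∫ s in (0)..t, v s = ∫ s in (0)..t, w s := by
  refine intervalIntegral.integral_congr_ae ?_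
  filter_upwards [ae_Icc_of_timeVol h] with s hs hst
  rw [uIoc_of_le ht.1] at hst
  exact hs ⟨hst.1.le, hst.2.trans ht.2⟩

theorem ae_mem_Icc (T : ℝ) : ∀ᵐ t ∂(timeVol T), t ∈ Icc 0 T := by
  filter_upwards [ae_restrict_mem measurableSet_Ioo] with t ht using Ioo_subset_Icc_self ht

theorem memLp_timeVol_of_continuous {E : Type*} [NormedAddCommGroup E] {T : ℝ} {v : ℝ → E}
    (hv : Continuous v) (p : ℝ≥0∞) : MemLp v p (timeVol T) := by
  obtain ⟨C, hC⟩ := (isCompact_Icc (a := (0 : ℝ)) (b := T)).exists_bound_of_continuousOn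
    hv.continuousOn
  exact MemLp.of_bound hv.aestronglyMeasurable C ((ae_mem_Icc T).mono hC)

/-- An element of `H²(0, T; X)` is determined by its second derivative and its initial values. -/
theorem BochnerH2.ae_eq_primitive {X : Type*} [NormedAddCommGroup X] [NormedSpace ℝ X]
    [CompleteSpace X] {T : ℝ} (hT : 0 < T) (u : BochnerH2 T X) {u₀ u₁ : X}
    (h₀ : HasInitialValue T u.val u₀) (h₁ : HasInitialValue T u.dt u₁) :
    ∃ U V : ℝ → X, (∀ t, V t = u₁ + ∫ s in (0)..t, u.dtt s) ∧
      (∀ t, U t = u₀ + ∫ s in (0)..t, V s) ∧ u.val =ᵐ[timeVol T] U ∧ u.dt =ᵐ[timeVol T] V := by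
  have hint : ∀ v : Lp X 2 (timeVol T), Integrable v (timeVol T) := fun v ↦
    (Lp.memLp v).integrable (by norm_num)
  obtain ⟨w₁, hw₁, hd, rfl⟩ := h₁
  obtain ⟨w₀, hw₀, hv, rfl⟩ := h₀
  have e₁ := eq_primitive_of_hasWeakTimeDeriv hT (hint _) u.hasWeakTimeDeriv_dt hw₁ hd
  have e₀ := eq_primitive_of_hasWeakTimeDeriv hT (hint _) u.hasWeakTimeDeriv_val hw₀ hv
  -- Primitives are taken on all of ℝ, because `energy_estimate` asks for the formulas at every t;
  -- they agree with the representatives on [0, T].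
  set V : ℝ → X := fun t ↦ w₁ 0 + ∫ s in (0)..t, u.dtt s
  have hV : u.dt =ᵐ[timeVol T] V := by
    filter_upwards [hd, ae_mem_Icc T] with t h1 h2
    rw [h1, e₁ t h2]
  refine ⟨fun t ↦ w₀ 0 + ∫ s in (0)..t, V s, V, fun _ ↦ rfl, fun _ ↦ rfl, ?_, hV⟩
  filter_upwards [hv, ae_mem_Icc T] with t h1 h2
  rw [h1, e₀ t h2, intervalIntegral_congr_timeVol h2 hV]

theorem hasWeakTimeDeriv_sub {X : Type*} [NormedAddCommGroup X] [NormedSpace ℝ X]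
    [CompleteSpace X] {T : ℝ} {a a' e e' : Lp X 2 (timeVol T)} (h : HasWeakTimeDeriv T a e)
    (h' : HasWeakTimeDeriv T a' e') : HasWeakTimeDeriv T ↑(a - a') ↑(e - e') := by
  intro φ
  have hφs : ContDiff ℝ ∞ φ := φ.contDiff
  have bint : ∀ {p : ℝ → ℝ} (_ : Continuous p) (_ : HasCompactSupport p)
      (q : Lp X 2 (timeVol T)), Integrable (fun t ↦ p t • q t) (timeVol T) := by
    intro p hp hpc q
    obtain ⟨C, hC⟩ := hpc.exists_bound_of_continuous hp
    exact ((Lp.memLp q).integrable (by norm_num)).bdd_smul C hp.aestronglyMeasurable (.of_forall hC)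
  have hsub : ∀ {p : ℝ → ℝ} (_ : Continuous p) (_ : HasCompactSupport p)
      (q q' : Lp X 2 (timeVol T)), ∫ t, p t • (q - q' : Lp X 2 (timeVol T)) t ∂(timeVol T)
        = ∫ t, p t • q t ∂(timeVol T) - ∫ t, p t • q' t ∂(timeVol T) := by
    intro p hp hpc q q'
    rw [← integral_sub (bint hp hpc q) (bint hp hpc q')]
    refine integral_congr_ae ?_
    filter_upwards [Lp.coeFn_sub q q'] with t ht
    rw [ht, Pi.sub_apply, smul_sub]
  rw [hsub (hφs.continuous_deriv (by simp)) φ.hasCompactSupport.deriv,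
    hsub φ.continuous φ.hasCompactSupport, h φ, h' φ]
  abel

theorem hasInitialValue_sub {X : Type*} [NormedAddCommGroup X] {T : ℝ}
    {a a' : Lp X 2 (timeVol T)} {x : X} (h : HasInitialValue T a x)
    (h' : HasInitialValue T a' x) : HasInitialValue T ↑(a - a') (0 : X) := by
  obtain ⟨p, hp, hap, rfl⟩ := h
  obtain ⟨p', hp', hap', h0⟩ := h'
  refine ⟨fun t ↦ p t - p' t, hp.sub hp', ?_, by simp [h0]⟩
  filter_upwards [Lp.coeFn_sub a a', hap, hap'] with t h1 h2 h3
  rw [h1, Pi.sub_apply, h2, h3]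

theorem norm_le_of_inner_le {X : Type*} [NormedAddCommGroup X] [InnerProductSpace ℝ X] {x : X}
    {C : ℝ} (hC : 0 ≤ C) (h : ∀ w, |inner ℝ x w| ≤ C * ‖w‖) : ‖x‖ ≤ C := by
  have h1 := h x
  rw [real_inner_self_eq_norm_sq, abs_of_nonneg (sq_nonneg _)] at h1
  rcases (norm_nonneg x).eq_or_lt with h0 | h0
  · rw [← h0]; exact hC
  · nlinarith

/-- Solvability in `H²(0, T; X)` of the abstract strongly damped wave equation with measurable
coefficients. -/
theorem exists_bochnerH2 {X H : Type*} [NormedAddCommGroup X] [InnerProductSpace ℝ X]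
    [FiniteDimensional ℝ X] [CompleteSpace X] [NormedAddCommGroup H] [InnerProductSpace ℝ H]
    [CompleteSpace H] (D : X →L[ℝ] H) {T m k : ℝ} (hT : 0 < T) (γ b : ℝ) {M K : ℝ → X →L[ℝ] X}
    {r : ℝ → X} (hM : AEStronglyMeasurable M (timeVol T)) (hK : AEStronglyMeasurable K (timeVol T))
    (hm : 0 < m) (hk : 0 ≤ k)
    (hcoer : ∀ᵐ t ∂(timeVol T), ∀ v, m * ‖v‖ ^ 2 ≤ inner ℝ (M t v) v)
    (hbd : ∀ᵐ t ∂(timeVol T), ∀ v, ‖K t v‖ ≤ k * ‖v‖) (hr : MemLp r 2 (timeVol T)) (u₀ u₁ : X) :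
    ∃ u : BochnerH2 T X, HasInitialValue T u.val u₀ ∧ HasInitialValue T u.dt u₁ ∧
      ∀ᵐ t ∂(timeVol T), ∀ φ, inner ℝ (M t (u.dtt t)) φ + γ * inner ℝ (D (u.val t)) (D φ)
        + b * inner ℝ (D (u.dt t)) (D φ) + inner ℝ (K t (u.dt t)) φ = inner ℝ (r t) φ := by
  -- The stiffness operator D*D turns the equation tested with every φ into an operator equation in
  -- X.
  let Λ : X →L[ℝ] X := D.adjoint ∘L D
  have hΛ : ∀ v w : X, inner ℝ (Λ v) w = inner ℝ (D v) (D w) := fun v w ↦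
    D.adjoint_inner_left w (D v)
  have hbd' : ∀ᵐ t ∂(timeVol T), ∀ v, ‖(b • Λ + K t) v‖ ≤ (‖b • Λ‖ + k) * ‖v‖ := by
    filter_upwards [hbd] with t ht v
    calc _ ≤ ‖(b • Λ) v‖ + ‖K t v‖ := norm_add_le _ _
      _ ≤ ‖b • Λ‖ * ‖v‖ + k * ‖v‖ := add_le_add ((b • Λ).le_opNorm v) (ht v)
      _ = _ := by ring
  obtain ⟨U, V, Z, hUc, hVc, hZ, hU, hV, heq⟩ := exists_secondOrder hT (γ • Λ) hM
    (aestronglyMeasurable_const.fun_add hK) hm (by positivity : 0 ≤ ‖b • Λ‖ + k)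
    hcoer hbd' hr u₀ u₁
  have hUm := memLp_timeVol_of_continuous (T := T) hUc 2
  have hVm := memLp_timeVol_of_continuous (T := T) hVc 2
  have hint : ∀ v : Lp X 2 (timeVol T), Integrable v (timeVol T) := fun v ↦
    (Lp.memLp v).integrable (by norm_num)
  refine ⟨⟨hUm.toLp, hVm.toLp, hZ.toLp, ?_, ?_⟩, ?_, ?_, ?_⟩
  · refine hasWeakTimeDeriv_primitive (x := u₀) hT (hint _) ?_
    filter_upwards [hUm.coeFn_toLp, ae_mem_Icc T] with t h1 h2
    rw [h1, hU t h2, intervalIntegral_congr_timeVol h2 hVm.coeFn_toLp]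
  · refine hasWeakTimeDeriv_primitive (x := u₁) hT (hint _) ?_
    filter_upwards [hVm.coeFn_toLp, ae_mem_Icc T] with t h1 h2
    rw [h1, hV t h2, intervalIntegral_congr_timeVol h2 hZ.coeFn_toLp]
  · exact ⟨U, hUc.continuousOn, hUm.coeFn_toLp, by simpa using hU 0 (left_mem_Icc.2 hT.le)⟩
  · exact ⟨V, hVc.continuousOn, hVm.coeFn_toLp, by simpa using hV 0 (left_mem_Icc.2 hT.le)⟩
  · filter_upwards [heq, hUm.coeFn_toLp, hVm.coeFn_toLp, hZ.coeFn_toLp] with t h1 h2 h3 h4 φ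
    rw [h2, h3, h4, ← h1, ← hΛ, ← hΛ]
    simp only [inner_add_left, _root_.add_apply, _root_.smul_apply, real_inner_smul_left]
    ring

variable {d : ℕ} {Ω : Opens (Space d)} {𝒯 : Triangulation Ω}

set_option maxHeartbeats 2000000 in
-- The discrete equation meets the hypotheses of `energy_estimate` with γ = c² and N = S‖β‖. No
-- inverse inequality is used, hence no constant depends on the mesh.
theorem IsSolution.energy {S : ℝ≥0}
    (hS : ∀ p ∈ H01 Ω, eLpNorm p.fst 6 (vol Ω) ≤ S * ‖p.snd‖ₑ) {c b α₀ T : ℝ} (hT : 0 < T)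
    (hb : 0 < b) (hα₀ : 0 < α₀) {α β f : ℝ → Space d → ℝ} {u₀ u₁ : femSpace 𝒯}
    (hα : MemMixed T Ω ⊤ ⊤ α) (hαl : ∀ᵐ z ∂((timeVol T).prod (vol Ω)), α₀ ≤ α z.1 z.2)
    (hβ : MemMixed T Ω ⊤ 3 β) (hf : MemMixed T Ω 2 2 f) {u : BochnerH2 T (femSpace 𝒯)}
    (hu : IsSolution c b T α β f u₀ u₁ u) {A κ R : ℝ} (hA : A = (c ^ 2) ^ 2 / b + 1)
    (hκ : κ = 4 * ((mixedNorm T Ω ⊤ 3 β).toReal * S) ^ 2 / (α₀ * b) + 4 * (c ^ 2 + A) / b + A)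
    (hR : R = Real.exp (κ * T) * ((b + 2 * (c ^ 2) ^ 2 / b + 1) * (‖grad u₀‖ ^ 2 + ‖grad u₁‖ ^ 2)
      + (mixedNorm T Ω 2 2 f).toReal ^ 2 / α₀)) :
    (∀ᵐ t ∂(timeVol T), b / 4 * ‖grad (u.dt t)‖ ^ 2 + ‖grad (u.val t)‖ ^ 2 ≤ R) ∧
      ∫ t, ‖fn (u.dtt t)‖ ^ 2 ∂(timeVol T) ≤ 2 / α₀ * R := by
  obtain ⟨U, V, hV, hU, hUe, hVe⟩ := u.ae_eq_primitive hT hu.initial_val hu.initial_dt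
  have hint : ∀ v : Lp (femSpace 𝒯) 2 (timeVol T), Integrable v (timeVol T) := fun v ↦
    (Lp.memLp v).integrable (by norm_num)
  obtain ⟨hf1, hf2, hf3⟩ := hf.two_two
  have hz2 : Integrable (fun t ↦ ‖fnL 𝒯 (u.dtt t)‖ ^ 2) (timeVol T) :=
    ((fnL 𝒯).comp_memLp' (Lp.memLp u.dtt)).integrable_norm_pow (by norm_num)
  have hg2 : Integrable (fun t ↦ (eLpNorm (f t) 2 (vol Ω)).toReal ^ 2) (timeVol T) := by
    simpa using hf2.integrable_norm_pow (by norm_num)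
  have key := energy_estimate (fnL 𝒯) (gradL 𝒯) (γ := c ^ 2)
    (N := (mixedNorm T Ω ⊤ 3 β).toReal * S) (R := R) hT hb (sq_nonneg c) hα₀
    ((hint u.dt).congr hVe) (hint u.dtt) hU hV hz2 hg2 (by
      filter_upwards [hu.equation, hUe, hVe, hα.ae_memLp, Measure.ae_ae_of_ae_prod hαl,
        hβ.ae_memLp, ae_eLpNorm_le_mixedNorm (Ω := Ω) (p := 3) β, hf1]
        with t heq h1 h2 hαt hαlt hβt hβn hft
      -- The test function φ = u_tt(t) varies with t; this is allowed because the null set in the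
      -- equation does not depend on φ.
      have e := heq (u.dtt t)
      have k1 := coercive_weight hαt hαlt (u.dtt t)
      obtain ⟨hm, hle⟩ := weight_three hS hβt (u.dt t)
      have k2 := (neg_le_abs _).trans (abs_integral_mul_le hm (fn (u.dtt t)))
      have k3 := (le_abs_self _).trans (abs_integral_mul_le hft (fn (u.dtt t)))
      have k4 : (eLpNorm (β t) 3 (vol Ω)).toReal * (S * ‖grad (u.dt t)‖)
          ≤ (mixedNorm T Ω ⊤ 3 β).toReal * S * ‖grad (u.dt t)‖ := by
        rw [mul_assoc]
        exact mul_le_mul_of_nonneg_right (ENNReal.toReal_mono hβ.2.ne hβn) (by positivity)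
      have k5 := k2.trans (mul_le_mul_of_nonneg_right (hle.trans k4) (norm_nonneg _))
      rw [← h1, ← h2]
      simp only [fnL_apply, gradL_apply]
      linarith) hA hκ (by rw [hf3]; exact hR)
  refine ⟨?_, key.2⟩
  filter_upwards [hUe, hVe, ae_mem_Icc T] with t h1 h2 ht
  rw [h1, h2]
  exact key.1 t ht

set_option maxHeartbeats 2000000 in
/-- The difference of two solutions solves the homogeneous problem. -/
theorem IsSolution.exists_sub {S : ℝ≥0}
    (hS : ∀ p ∈ H01 Ω, eLpNorm p.fst 6 (vol Ω) ≤ S * ‖p.snd‖ₑ) {c b T : ℝ}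
    {α β f : ℝ → Space d → ℝ} {u₀ u₁ : femSpace 𝒯}
    (hα : MemMixed T Ω ⊤ ⊤ α) (hβ : MemMixed T Ω ⊤ 3 β) {u w : BochnerH2 T (femSpace 𝒯)}
    (hu : IsSolution c b T α β f u₀ u₁ u) (hw : IsSolution c b T α β f u₀ u₁ w) :
    ∃ y : BochnerH2 T (femSpace 𝒯), y.val = u.val - w.val ∧ y.dt = u.dt - w.dt ∧
      y.dtt = u.dtt - w.dtt ∧ IsSolution c b T α β (fun _ _ ↦ 0) 0 0 y := by
  refine ⟨⟨u.val - w.val, u.dt - w.dt, u.dtt - w.dtt,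
    hasWeakTimeDeriv_sub u.hasWeakTimeDeriv_val w.hasWeakTimeDeriv_val,
    hasWeakTimeDeriv_sub u.hasWeakTimeDeriv_dt w.hasWeakTimeDeriv_dt⟩, rfl, rfl, rfl, ?_,
    hasInitialValue_sub hu.initial_val hw.initial_val,
    hasInitialValue_sub hu.initial_dt hw.initial_dt⟩
  filter_upwards [hu.equation, hw.equation, Lp.coeFn_sub u.val w.val, Lp.coeFn_sub u.dt w.dt,
    Lp.coeFn_sub u.dtt w.dtt, hα.ae_memLp, hβ.ae_memLp] with t e1 e2 s0 s1 s2 hαt hβt φ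
  obtain ⟨La, hLa⟩ := exists_bilin_integral_mul (𝒯 := 𝒯) (fun v ↦ weight_top hαt v)
  obtain ⟨Lb, hLb⟩ := exists_bilin_integral_mul (𝒯 := 𝒯) (fun v ↦ (weight_three hS hβt v).1)
  have k1 := e1 φ
  have k2 := e2 φ
  simp only [hLa, hLb] at k1 k2 ⊢
  rw [s0, s1, s2]
  simp only [Pi.sub_apply, ← gradL_apply, map_sub, LinearMap.sub_apply, inner_sub_left, zero_mul,
    integral_zero] at k1 k2 ⊢
  linarith

theorem memMixed_zero {T : ℝ} {q p : ℝ≥0∞} : MemMixed T Ω q p (fun _ _ ↦ 0) := by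
  refine ⟨aestronglyMeasurable_const, ?_⟩
  simp [mixedNorm]

set_option maxHeartbeats 2000000 in
-- The difference has zero data, so its energy bound is R = 0. All three components of a `BochnerH2`
-- element have to be shown to vanish: two by the gradients, the second derivative by its L² norm.
theorem IsSolution.eq {S : ℝ≥0}
    (hS : ∀ p ∈ H01 Ω, eLpNorm p.fst 6 (vol Ω) ≤ S * ‖p.snd‖ₑ) {c b α₀ T : ℝ} (hT : 0 < T)
    (hb : 0 < b) (hα₀ : 0 < α₀) {α β f : ℝ → Space d → ℝ} {u₀ u₁ : femSpace 𝒯}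
    (hα : MemMixed T Ω ⊤ ⊤ α) (hαl : ∀ᵐ z ∂((timeVol T).prod (vol Ω)), α₀ ≤ α z.1 z.2)
    (hβ : MemMixed T Ω ⊤ 3 β) {u w : BochnerH2 T (femSpace 𝒯)}
    (hu : IsSolution c b T α β f u₀ u₁ u) (hw : IsSolution c b T α β f u₀ u₁ w) : u = w := by
  obtain ⟨y, y0, y1, y2, hy⟩ := hu.exists_sub hS hα hβ hw
  obtain ⟨h1, h2⟩ := hy.energy hS hT hb hα₀ hα hαl hβ memMixed_zero rfl rfl rfl
  have hg0 : grad (0 : femSpace 𝒯) = 0 := rfl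
  have hm0 : mixedNorm T Ω 2 2 (fun _ _ ↦ 0) = 0 := by simp [mixedNorm]
  simp only [hg0, hm0, norm_zero, ENNReal.toReal_zero, ne_eq, OfNat.ofNat_ne_zero,
    not_false_eq_true, zero_pow, add_zero, mul_zero, zero_div] at h1 h2
  have hval : y.val = 0 := by
    rw [Lp.eq_zero_iff_ae_eq_zero]
    filter_upwards [h1] with t ht
    refine eq_zero_of_grad_eq_zero hS ?_
    have : ‖grad (y.val t)‖ ^ 2 ≤ 0 := by
      have : 0 ≤ b / 4 * ‖grad (y.dt t)‖ ^ 2 := by positivity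
      linarith
    simpa using this
  have hdt : y.dt = 0 := by
    rw [Lp.eq_zero_iff_ae_eq_zero]
    filter_upwards [h1] with t ht
    refine eq_zero_of_grad_eq_zero hS ?_
    have : ‖grad (y.dt t)‖ ^ 2 ≤ 0 := by
      nlinarith [sq_nonneg ‖grad (y.val t)‖]
    simpa using this
  have hdtt : y.dtt = 0 := by
    rw [Lp.eq_zero_iff_ae_eq_zero]
    have hz2 : Integrable (fun t ↦ ‖fn (y.dtt t)‖ ^ 2) (timeVol T) :=
      ((fnL 𝒯).comp_memLp' (Lp.memLp y.dtt)).integrable_norm_pow (by norm_num)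
    have h0 : 0 ≤ fun t ↦ ‖fn (y.dtt t)‖ ^ 2 := fun t ↦ by positivity
    have := (integral_eq_zero_iff_of_nonneg h0 hz2).1
      (le_antisymm h2 (integral_nonneg h0))
    filter_upwards [this] with t ht
    refine eq_zero_of_fn_eq_zero ?_
    simpa using ht
  rw [hval] at y0
  rw [hdt] at y1
  rw [hdtt] at y2
  cases u
  cases w
  simp only [BochnerH2.mk.injEq]
  exact ⟨sub_eq_zero.1 y0.symm, sub_eq_zero.1 y1.symm, sub_eq_zero.1 y2.symm⟩

set_option maxHeartbeats 2000000 in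
/-- Existence of a solution of the semi-discrete problem. -/
theorem exists_isSolution {S : ℝ≥0}
    (hS : ∀ p ∈ H01 Ω, eLpNorm p.fst 6 (vol Ω) ≤ S * ‖p.snd‖ₑ) {c b α₀ T : ℝ} (hT : 0 < T)
    (hα₀ : 0 < α₀) {α β f : ℝ → Space d → ℝ} (u₀ u₁ : femSpace 𝒯)
    (hα : MemMixed T Ω ⊤ ⊤ α) (hαl : ∀ᵐ z ∂((timeVol T).prod (vol Ω)), α₀ ≤ α z.1 z.2)
    (hβ : MemMixed T Ω ⊤ 3 β) (hf : MemMixed T Ω 2 2 f) :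
    ∃ u : BochnerH2 T (femSpace 𝒯), IsSolution c b T α β f u₀ u₁ u := by
  have hfnm : ∀ v : femSpace 𝒯, AEStronglyMeasurable (fn v) (vol Ω) := fun v ↦
    Lp.aestronglyMeasurable _
  obtain ⟨M, hMm, hM⟩ := exists_operator_of_bilin (μ := timeVol T)
    (B := fun t (v w : femSpace 𝒯) ↦ ∫ x, α t x * fn v x * fn w x ∂(vol Ω))
    (fun v w ↦ by
      simp only [mul_assoc]
      exact aestronglyMeasurable_integral_mul hα.1 ((hfnm v).mul (hfnm w)))
    (by filter_upwards [hα.ae_memLp] with t ht using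
      exists_bilin_integral_mul (fun v ↦ weight_top ht v))
  obtain ⟨Kβ, hKm, hK⟩ := exists_operator_of_bilin (μ := timeVol T)
    (B := fun t (v w : femSpace 𝒯) ↦ ∫ x, β t x * fn v x * fn w x ∂(vol Ω))
    (fun v w ↦ by
      simp only [mul_assoc]
      exact aestronglyMeasurable_integral_mul hβ.1 ((hfnm v).mul (hfnm w)))
    (by filter_upwards [hβ.ae_memLp] with t ht using
      exists_bilin_integral_mul (fun v ↦ (weight_three hS ht v).1))
  obtain ⟨hf1, hf2, -⟩ := hf.two_two
  obtain ⟨r, hrm, hr⟩ := exists_vector_of_linear (μ := timeVol T)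
    (B := fun t (w : femSpace 𝒯) ↦ ∫ x, f t x * fn w x ∂(vol Ω))
    (fun w ↦ aestronglyMeasurable_integral_mul hf.1 (hfnm w))
    (by filter_upwards [hf1] with t ht using exists_linear_integral_mul 𝒯 ht)
  -- An injective linear map on a finite-dimensional space is bounded below, so the H¹ norm is
  -- controlled by the L² norm. This `L` depends on the mesh and serves existence only.
  obtain ⟨L, hL0, hL⟩ := (fnL 𝒯 : femSpace 𝒯 →ₗ[ℝ] Lp ℝ 2 (vol Ω)).exists_antilipschitzWith
    (LinearMap.ker_eq_bot'.2 fun v hv ↦ eq_zero_of_fn_eq_zero hv)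
  have hLb : ∀ v : femSpace 𝒯, ‖v‖ ≤ L * ‖fn v‖ := fun v ↦ by
    simpa using hL.le_mul_norm (map_zero _) v
  have hL0' : (0 : ℝ) < L := hL0
  set m : ℝ := α₀ / (L : ℝ) ^ 2
  have hcoer : ∀ᵐ t ∂(timeVol T), ∀ v, m * ‖v‖ ^ 2 ≤ inner ℝ (M t v) v := by
    filter_upwards [hM, hα.ae_memLp, Measure.ae_ae_of_ae_prod hαl] with t h1 h2 h3 v
    rw [h1]
    refine le_trans ?_ (coercive_weight h2 h3 v)
    calc m * ‖v‖ ^ 2 ≤ m * (L * ‖fn v‖) ^ 2 := by gcongr; exact hLb v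
      _ = α₀ * ‖fn v‖ ^ 2 := by simp only [m]; field_simp
  set k : ℝ := (mixedNorm T Ω ⊤ 3 β).toReal * (S * ‖gradL 𝒯‖) * ‖fnL 𝒯‖
  have hk : 0 ≤ k := by positivity
  have hbd : ∀ᵐ t ∂(timeVol T), ∀ v, ‖Kβ t v‖ ≤ k * ‖v‖ := by
    filter_upwards [hK, hβ.ae_memLp, ae_eLpNorm_le_mixedNorm (Ω := Ω) (p := 3) β]
      with t h1 h2 h3 v
    refine norm_le_of_inner_le (mul_nonneg hk (norm_nonneg v)) fun w ↦ ?_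
    rw [h1]
    obtain ⟨hm, hle⟩ := weight_three hS h2 v
    calc _ ≤ _ := abs_integral_mul_le hm (fn w)
      _ ≤ ((eLpNorm (β t) 3 (vol Ω)).toReal * (S * ‖grad v‖)) * ‖fn w‖ :=
        mul_le_mul_of_nonneg_right hle (norm_nonneg _)
      _ ≤ ((mixedNorm T Ω ⊤ 3 β).toReal * (S * (‖gradL 𝒯‖ * ‖v‖))) * (‖fnL 𝒯‖ * ‖w‖) := by
        have e1 := ENNReal.toReal_mono hβ.2.ne h3
        have e2 : ‖grad v‖ ≤ ‖gradL 𝒯‖ * ‖v‖ := (gradL 𝒯).le_opNorm v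
        have e3 : ‖fn w‖ ≤ ‖fnL 𝒯‖ * ‖w‖ := (fnL 𝒯).le_opNorm w
        gcongr
      _ = _ := by simp only [k]; ring
  have hr2 : MemLp r 2 (timeVol T) := by
    refine (hf2.const_mul ‖fnL 𝒯‖).mono' hrm ?_
    filter_upwards [hr, hf1] with t h1 h2
    refine norm_le_of_inner_le (by positivity) fun w ↦ ?_
    rw [h1]
    calc _ ≤ _ := abs_integral_mul_le h2 (fn w)
      _ ≤ (eLpNorm (f t) 2 (vol Ω)).toReal * (‖fnL 𝒯‖ * ‖w‖) := by
        gcongr; exact (fnL 𝒯).le_opNorm w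
      _ = _ := by ring
  obtain ⟨u, h₀, h₁, heq⟩ := exists_bochnerH2 (gradL 𝒯) hT (c ^ 2) b hMm hKm
    (by positivity : 0 < m) hk hcoer hbd hr2 u₀ u₁
  refine ⟨u, ⟨?_, h₀, h₁⟩⟩
  filter_upwards [heq, hM, hK, hr] with t h1 h5 h6 h7 φ
  rw [← h5, ← h6, ← h7]
  exact h1 φ

theorem eLpNorm_top_sq_le {τ E : Type*} [MeasurableSpace τ] {μ : Measure τ}
    [NormedAddCommGroup E] {w : τ → E} {R : ℝ} (hR : 0 ≤ R) (h : ∀ᵐ t ∂μ, ‖w t‖ ^ 2 ≤ R) :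
    eLpNorm w ⊤ μ ^ 2 ≤ ENNReal.ofReal R := by
  have h1 : eLpNorm w ⊤ μ ≤ ENNReal.ofReal √R := by
    rw [eLpNorm_exponent_top]
    refine eLpNormEssSup_le_of_ae_bound ?_
    filter_upwards [h] with t ht using Real.le_sqrt_of_sq_le ht
  calc _ ≤ ENNReal.ofReal √R ^ 2 := by gcongr
    _ = _ := by rw [← ENNReal.ofReal_pow (Real.sqrt_nonneg _), Real.sq_sqrt hR]

theorem eLpNorm_two_sq {τ E : Type*} [MeasurableSpace τ] {μ : Measure τ}
    [NormedAddCommGroup E] {w : τ → E} (h : MemLp w 2 μ) :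
    eLpNorm w 2 μ ^ 2 = ENNReal.ofReal (∫ t, ‖w t‖ ^ 2 ∂μ) := by
  have h1 := eLpNorm_nnreal_pow_eq_lintegral (μ := μ) (p := 2) (f := w) (by simp)
  rw [ofReal_integral_eq_lintegral_ofReal (h.integrable_norm_pow (by norm_num))
    (.of_forall fun t ↦ by positivity)]
  simp only [ENNReal.ofReal_pow (norm_nonneg _), ofReal_norm]
  simpa using h1

end Solutions

/-! ### Collecting the constants. -/

section Main

open scoped NNReal

/-- The factor in front of the energy bound is dominated by an exponential. -/
theorem total_bound_le {a b γ A S B N T X Y q p : ℝ} (hb : 0 < b) (ha : 0 < a) (hT : 0 ≤ T)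
    (hγ : 0 ≤ γ) (hA : 0 ≤ A) (hX : 0 ≤ X) (hY : 0 ≤ Y)
    (hq : q = 4 * (N * S) ^ 2 / (a * b) + 4 * (γ + A) / b + A) (hp : 0 ≤ p) :
    2 / a * (Real.exp (q * T) * (p * X + Y / a)) + Real.exp (q * T) * (p * X + Y / a)
        + 4 / b * (Real.exp (q * T) * (p * X + Y / a))
        + T * (4 / b * (Real.exp (q * T) * (p * X + Y / a)))
      ≤ (2 / a + 1 + 8 / b) * (p + 1 / a)
        * Real.exp ((4 * S ^ 2 / (a * b) + 4 * (γ + A) / b + A + 1) * (B ^ 2 + N ^ 2 + 1) * T)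
        * (X + Y) := by
  set G := 4 * S ^ 2 / (a * b) + 4 * (γ + A) / b + A with hG
  have hG0 : 0 ≤ G := by positivity
  -- The norm `B` of α only enlarges the exponent. The extra 1 in q + 1 is reserved for the factor T
  -- below.
  have h1 : q + 1 ≤ (G + 1) * (B ^ 2 + N ^ 2 + 1) := by
    have e : q = 4 * S ^ 2 / (a * b) * N ^ 2 + (4 * (γ + A) / b + A) := by rw [hq]; ring
    have h2 : 0 ≤ 4 * S ^ 2 / (a * b) := by positivity
    have h3 : 0 ≤ 4 * (γ + A) / b + A := by positivity
    have h4 : q ≤ G * (N ^ 2 + 1) := by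
      rw [e, hG]
      nlinarith [mul_nonneg h3 (sq_nonneg N)]
    nlinarith [mul_nonneg hG0 (sq_nonneg B), sq_nonneg B, sq_nonneg N]
  set e := Real.exp ((G + 1) * (B ^ 2 + N ^ 2 + 1) * T)
  have h5 : Real.exp ((q + 1) * T) ≤ e := Real.exp_le_exp.2 (mul_le_mul_of_nonneg_right h1 hT)
  have h6 : Real.exp (q * T) ≤ e :=
    (Real.exp_le_exp.2 (by nlinarith)).trans h5
  -- The factor T, from bounding the L² norm in time by the supremum, is absorbed through T ≤
  -- exp(T).
  have h7 : T * Real.exp (q * T) ≤ e := by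
    refine le_trans ?_ h5
    rw [add_mul, one_mul, Real.exp_add, mul_comm]
    gcongr
    linarith [Real.add_one_le_exp T]
  set Z := p * X + Y / a
  have hZ0 : 0 ≤ Z := by positivity
  have hZ : Z ≤ (p + 1 / a) * (X + Y) := by
    have e1 : (p + 1 / a) * (X + Y) = Z + (p * Y + 1 / a * X) := by simp only [Z]; ring
    have : 0 ≤ p * Y + 1 / a * X := by positivity
    linarith
  have he : 0 < e := Real.exp_pos _
  calc _ = (2 / a + 1 + 4 / b) * (Real.exp (q * T) * Z) + 4 / b * (T * Real.exp (q * T) * Z) := by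
        ring
    _ ≤ (2 / a + 1 + 4 / b) * (e * Z) + 4 / b * (e * Z) := by gcongr
    _ = (2 / a + 1 + 8 / b) * e * Z := by ring
    _ ≤ (2 / a + 1 + 8 / b) * e * ((p + 1 / a) * (X + Y)) := by gcongr
    _ = _ := by ring

variable {d : ℕ} {Ω : Opens (Space d)} {𝒯 : Triangulation Ω}

set_option maxHeartbeats 1000000 in
/-- The four norms of the energy estimate in terms of a pointwise bound. -/
theorem sum_eLpNorm_le {b a T R : ℝ} (hT : 0 < T) (hb : 0 < b) (ha : 0 < a)
    (u : BochnerH2 T (femSpace 𝒯)) (hR : 0 ≤ R)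
    (h1 : ∀ᵐ t ∂(timeVol T), b / 4 * ‖grad (u.dt t)‖ ^ 2 + ‖grad (u.val t)‖ ^ 2 ≤ R)
    (h2 : ∫ t, ‖fn (u.dtt t)‖ ^ 2 ∂(timeVol T) ≤ 2 / a * R) :
    eLpNorm (fun t => fn (u.dtt t)) 2 (timeVol T) ^ 2
        + eLpNorm (fun t => grad (u.val t)) ⊤ (timeVol T) ^ 2
        + eLpNorm (fun t => grad (u.dt t)) ⊤ (timeVol T) ^ 2
        + eLpNorm (fun t => grad (u.dt t)) 2 (timeVol T) ^ 2
      ≤ ENNReal.ofReal (2 / a * R + R + 4 / b * R + T * (4 / b * R)) := by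
  have hdt : ∀ᵐ t ∂(timeVol T), ‖grad (u.dt t)‖ ^ 2 ≤ 4 / b * R := by
    filter_upwards [h1] with t ht
    rw [div_mul_eq_mul_div, le_div_iff₀ hb]
    nlinarith [sq_nonneg ‖grad (u.val t)‖]
  have hval : ∀ᵐ t ∂(timeVol T), ‖grad (u.val t)‖ ^ 2 ≤ R := by
    filter_upwards [h1] with t ht
    have : 0 ≤ b / 4 * ‖grad (u.dt t)‖ ^ 2 := by positivity
    linarith
  have m1 : MemLp (fun t ↦ fn (u.dtt t)) 2 (timeVol T) := (fnL 𝒯).comp_memLp' (Lp.memLp u.dtt)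
  have m2 : MemLp (fun t ↦ grad (u.dt t)) 2 (timeVol T) := (gradL 𝒯).comp_memLp' (Lp.memLp u.dt)
  have h3 : ∫ t, ‖grad (u.dt t)‖ ^ 2 ∂(timeVol T) ≤ T * (4 / b * R) := by
    refine (integral_mono_ae (m2.integrable_norm_pow (by norm_num)) (integrable_const _)
      hdt).trans (le_of_eq ?_)
    simp [hT.le]
  have hR' : 0 ≤ 4 / b * R := by positivity
  rw [ENNReal.ofReal_add (by positivity) (by positivity),
    ENNReal.ofReal_add (by positivity) (by positivity),
    ENNReal.ofReal_add (by positivity) (by positivity), eLpNorm_two_sq m1, eLpNorm_two_sq m2]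
  exact add_le_add (add_le_add (add_le_add (ENNReal.ofReal_le_ofReal h2)
    (eLpNorm_top_sq_le hR hval)) (eLpNorm_top_sq_le hR' hdt)) (ENNReal.ofReal_le_ofReal h3)

end Main

end StrongDamping

/-! ### The theorem. -/

open StrongDamping
theorem mainTheorem3 (d : ℕ) (hd : d = 2 ∨ d = 3) (Ω : Opens (Space d))
    (hΩ : IsConvexPolytope Ω) (c b α₀ : ℝ) (hc : 0 < c ^ 2) (hb : 0 < b) (hα₀ : 0 < α₀) :
    ∃ C₁ C₂ : ℝ, 0 < C₁ ∧ 0 < C₂ ∧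
      ∀ (T : ℝ), 0 < T → ∀ (𝒯 : Triangulation Ω) (α β f : ℝ → Space d → ℝ)
        (u₀ u₁ : femSpace 𝒯),
        MemMixed T Ω ⊤ ⊤ α →
        (∀ᵐ z ∂((timeVol T).prod (vol Ω)), α₀ ≤ α z.1 z.2) →
        MemMixed T Ω ⊤ 3 β →
        MemMixed T Ω 2 2 f →
        (∃! u : BochnerH2 T (femSpace 𝒯), IsSolution c b T α β f u₀ u₁ u) ∧
        ∀ u : BochnerH2 T (femSpace 𝒯), IsSolution c b T α β f u₀ u₁ u →
          eLpNorm (fun t => fn (u.dtt t)) 2 (timeVol T) ^ 2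
            + eLpNorm (fun t => grad (u.val t)) ⊤ (timeVol T) ^ 2
            + eLpNorm (fun t => grad (u.dt t)) ⊤ (timeVol T) ^ 2
            + eLpNorm (fun t => grad (u.dt t)) 2 (timeVol T) ^ 2
          ≤ ENNReal.ofReal
            (C₁ * Real.exp (C₂ * ((mixedNorm T Ω ⊤ 3 α).toReal ^ 2
                + (mixedNorm T Ω ⊤ 3 β).toReal ^ 2 + 1) * T)
              * (‖grad u₀‖ ^ 2 + ‖grad u₁‖ ^ 2 + (mixedNorm T Ω 2 2 f).toReal ^ 2)) := by
  -- `S` is fixed before T, the mesh and the data, so C₁ and C₂, read off from `total_bound_le` with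
  -- γ = c² and A = c⁴/b + 1, are independent of them.
  obtain ⟨S, hS⟩ := exists_sobolev hd hΩ.isBounded
  have hA : 0 ≤ (c ^ 2) ^ 2 / b + 1 := by positivity
  have hp : 0 ≤ b + 2 * (c ^ 2) ^ 2 / b + 1 := by positivity
  refine ⟨(2 / α₀ + 1 + 8 / b) * (b + 2 * (c ^ 2) ^ 2 / b + 1 + 1 / α₀),
    4 * (S : ℝ) ^ 2 / (α₀ * b) + 4 * (c ^ 2 + ((c ^ 2) ^ 2 / b + 1)) / b
      + ((c ^ 2) ^ 2 / b + 1) + 1, by positivity, by positivity, ?_⟩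
  intro T hT 𝒯 α β f u₀ u₁ hα hαl hβ hf
  constructor
  · obtain ⟨u, hu⟩ := exists_isSolution (c := c) (b := b) hS hT hα₀ u₀ u₁ hα hαl hβ hf
    exact ⟨u, hu, fun w hw ↦ hw.eq hS hT hb hα₀ hα hαl hβ hu⟩
  · intro u hu
    obtain ⟨h1, h2⟩ := hu.energy hS hT hb hα₀ hα hαl hβ hf rfl rfl rfl
    refine (sum_eLpNorm_le hT hb hα₀ u (by positivity) h1 h2).trans (ENNReal.ofReal_le_ofReal ?_)
    exact total_bound_le hb hα₀ hT.le hc.le hA (by positivity) (by positivity) rfl hp
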